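/- Let $\alpha,\beta\in\mathbb{R}$ and $\gamma\in\mathbb{C}$. For $\Psi\in H^1((0,\infty)\times\mathbb{R})\oplus H^1((-\infty,0)\times\mathbb{R})$ put $$\mathbf a_0[\Psi]=\int_{\mathbb{R}^2}\Big(\big|\tfrac{\partial\Psi}{\partial x}\big|^2+\tfrac12\big|\tfrac{\partial\Psi}{\partial y}\big|^2+\tfrac12y^2|\Psi|^2\Big)\,dx\,dy\in[0,\infty],$$ where the weak derivatives are taken on the two half-planes separately, and let $D$ be the set of all such $\Psi$ with $\mathbf a_0[\Psi]<\infty$. Let $\Psi(0\pm,y)$ denote the one-sided boundary values of $\Psi$ on the axis $x=0$. Define \begin{align*} \mathbf b_1[\Psi]&=\int_{\mathbb R} y\,|\Psi(0+,y)-\Psi(0-,y)|^2\,dy,\\ \mathbf b_2[\Psi]&=\int_{\mathbb R}\tfrac{\alpha\beta+|\gamma|^2}{4}\,y\,|\Psi(0+,y)+\Psi(0-,y)|^2\,dy,\\ \mathbf b_3[\Psi]&=\int_{\mathbb R} y\,\mathrm{Re}\big[\gamma\big(\overline{\Psi(0+,y)}+\overline{\Psi(0-,y)}\big)\big(\Psi(0+,y)-\Psi(0-,y)\big)\big]\,dy,\\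 \mathbf b_4[\Psi]&=\int_{\mathbb R}\tfrac{\alpha}{4}\,y\,|\Psi(0+,y)+\Psi(0-,y)|^2\,dy, \end{align*} and $\mathbf a_{\alpha,\beta,\gamma}[\Psi]=\mathbf a_0[\Psi]+\frac1\beta\big(\mathbf b_1[\Psi]+\mathbf b_2[\Psi]+\mathbf b_3[\Psi]\big)$ for $\beta\neq0$, $\mathbf a_{\alpha,0,\gamma}[\Psi]=\mathbf a_0[\Psi]+\mathbf b_4[\Psi]$. Let $$\kappa=\big|4+\alpha\beta+|\gamma|^2\big|+\sqrt{(\alpha\beta+|\gamma|^2-4)^2+16|\gamma|^2}.$$ Then for every $\Psi\in D$ the boundary values $\Psi(0\pm,y)$ exist for almost every $y$, the integrals $\mathbf b_1,\dots,\mathbf b_4$ converge absolutely, and $$\mathbf b_1[\Psi]+\mathbf b_2[\Psi]+\mathbf b_3[\Psi]\le\frac{\kappa}{2\sqrt2}\,\mathbf a_0[\Psi],\qquad \mathbf b_4[\Psi]\le\frac{|\alpha|}{\sqrt2}\,\mathbf a_0[\Psi].$$ If $\beta\ne0$, then $$\mathbf a_{\alpha,\beta,\gamma}[\Psi]\ge\Big(1-\frac{\kappa}{2\sqrt2\,|\beta|}\Big)\mathbf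 a_0[\Psi],$$ and, provided that $\kappa\le2\sqrt2\,|\beta|$, the right-hand side is at least $\frac12\big(1-\frac{\kappa}{2\sqrt2|\beta|}\big)\|\Psi\|^2_{L^2(\mathbb R^2)}$. If $\beta=0$, then $$\mathbf a_{\alpha,0,\gamma}[\Psi]\ge\Big(1-\frac{|\alpha|}{\sqrt2}\Big)\mathbf a_0[\Psi],$$ and, provided that $|\alpha|\le\sqrt2$, the right-hand side is at least $\frac12\big(1-\frac{|\alpha|}{\sqrt2}\big)\|\Psi\|^2_{L^2(\mathbb R^2)}$. -/

import Mathlib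

open MeasureTheory Filter Topology Set
open scoped ContDiff ComplexConjugate

noncomputable section

namespace SpectralTransition

/-- The open half-plane `(0,∞) × ℝ`. -/
def rightHalf : Set (ℝ × ℝ) := {p | 0 < p.1}

/-- The open half-plane `(-∞,0) × ℝ`. -/
def leftHalf : Set (ℝ × ℝ) := {p | p.1 < 0}

/-- The unit vector in the direction of `x`. -/
def ex : ℝ × ℝ := (1, 0)

/-- The unit vector in the direction of `y`. -/
def ey : ℝ × ℝ := (0, 1)

/-- `g` is the weak (distributional) derivative of `f` in the direction `v` on the open set `Ω`:
both are locally integrable on `Ω`, and `∫_Ω f ∂_v φ = - ∫_Ω g φ` for every test function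
`φ ∈ C_c^∞(Ω)`. -/
def HasWeakDeriv (Ω : Set (ℝ × ℝ)) (v : ℝ × ℝ) (f g : ℝ × ℝ → ℂ) : Prop :=
  LocallyIntegrableOn f Ω ∧ LocallyIntegrableOn g Ω ∧
    ∀ φ : ℝ × ℝ → ℝ, ContDiff ℝ ∞ φ → HasCompactSupport φ → tsupport φ ⊆ Ω →
      ∫ p in Ω, (fderiv ℝ φ p v) • f p = - ∫ p in Ω, φ p • g p

open Classical in
/-- The weak derivative of `f` in the direction `v` on `Ω`, which is unique up to a null subset of
`Ω` (and the zero function if there is none). -/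
def weakDeriv (Ω : Set (ℝ × ℝ)) (v : ℝ × ℝ) (f : ℝ × ℝ → ℂ) : ℝ × ℝ → ℂ :=
  if h : ∃ g, HasWeakDeriv Ω v f g then h.choose else 0

/-- The restriction of `f` to `Ω` belongs to the Sobolev space `H¹(Ω)`: it lies in `L²(Ω)`, and so
do its two first-order weak derivatives. -/
def MemH1 (Ω : Set (ℝ × ℝ)) (f : ℝ × ℝ → ℂ) : Prop :=
  MemLp f 2 (volume.restrict Ω) ∧
    (∃ g, HasWeakDeriv Ω ex f g ∧ MemLp g 2 (volume.restrict Ω)) ∧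
    (∃ g, HasWeakDeriv Ω ey f g ∧ MemLp g 2 (volume.restrict Ω))

/-- The energy `∫_Ω (|∂_x Ψ|² + ½ |∂_y Ψ|² + ½ y² |Ψ|²)`, with values in `[0,∞]`. -/
def energyOn (Ω : Set (ℝ × ℝ)) (Ψ : ℝ × ℝ → ℂ) : ENNReal :=
  ∫⁻ p in Ω, ENNReal.ofReal
    (‖weakDeriv Ω ex Ψ p‖ ^ 2 + (1 / 2) * ‖weakDeriv Ω ey Ψ p‖ ^ 2
      + (1 / 2) * p.2 ^ 2 * ‖Ψ p‖ ^ 2)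

/-- The form `a₀`, with values in `[0,∞]`. The derivatives are taken on the two half-planes
separately, the jump across the axis `x = 0` does not contribute. -/
def extendedA0 (Ψ : ℝ × ℝ → ℂ) : ENNReal :=
  energyOn rightHalf Ψ + energyOn leftHalf Ψ

/-- The form domain
`D = {Ψ ∈ H¹((0,∞) × ℝ) ⊕ H¹((-∞,0) × ℝ) : a₀[Ψ] < ∞}`. -/
def formDomain : Set (ℝ × ℝ → ℂ) :=
  {Ψ | MemH1 rightHalf Ψ ∧ MemH1 leftHalf Ψ ∧ extendedA0 Ψ < ⊤}

/-- The form `a₀` as a real number, for `Ψ` in the form domain. -/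
def a0 (Ψ : ℝ × ℝ → ℂ) : ℝ := (extendedA0 Ψ).toReal

/-- The filter of `x → 0+` outside null sets. Limits along it do not depend on the choice of a
representative of a function of `x`. -/
def zeroPlus : Filter ℝ := 𝓝[>] 0 ⊓ ae volume

/-- The filter of `x → 0-` outside null sets. -/
def zeroMinus : Filter ℝ := 𝓝[<] 0 ⊓ ae volume

/-- The boundary value `Ψ(0+, y) = lim_{x → 0+} Ψ(x, y)`. -/
def rightTrace (Ψ : ℝ × ℝ → ℂ) (y : ℝ) : ℂ := limUnder zeroPlus fun x => Ψ (x, y)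

/-- The boundary value `Ψ(0-, y) = lim_{x → 0-} Ψ(x, y)`. -/
def leftTrace (Ψ : ℝ × ℝ → ℂ) (y : ℝ) : ℂ := limUnder zeroMinus fun x => Ψ (x, y)

/-- The integrand of `b₁`. -/
def b1Integrand (Ψ : ℝ × ℝ → ℂ) (y : ℝ) : ℝ :=
  y * ‖rightTrace Ψ y - leftTrace Ψ y‖ ^ 2

/-- The integrand of `b₂`. -/
def b2Integrand (α β : ℝ) (γ : ℂ) (Ψ : ℝ × ℝ → ℂ) (y : ℝ) : ℝ :=
  (α * β + ‖γ‖ ^ 2) / 4 * y * ‖rightTrace Ψ y + leftTrace Ψ y‖ ^ 2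

/-- The integrand of `b₃`. -/
def b3Integrand (γ : ℂ) (Ψ : ℝ × ℝ → ℂ) (y : ℝ) : ℝ :=
  y * (γ * (conj (rightTrace Ψ y) + conj (leftTrace Ψ y))
    * (rightTrace Ψ y - leftTrace Ψ y)).re

/-- The integrand of `b₄`. -/
def b4Integrand (α : ℝ) (Ψ : ℝ × ℝ → ℂ) (y : ℝ) : ℝ :=
  α / 4 * y * ‖rightTrace Ψ y + leftTrace Ψ y‖ ^ 2

/-- The boundary form `b₁`. -/
def b1 (Ψ : ℝ × ℝ → ℂ) : ℝ := ∫ y, b1Integrand Ψ y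

/-- The boundary form `b₂`. -/
def b2 (α β : ℝ) (γ : ℂ) (Ψ : ℝ × ℝ → ℂ) : ℝ := ∫ y, b2Integrand α β γ Ψ y

/-- The boundary form `b₃`. -/
def b3 (γ : ℂ) (Ψ : ℝ × ℝ → ℂ) : ℝ := ∫ y, b3Integrand γ Ψ y

/-- The boundary form `b₄`. -/
def b4 (α : ℝ) (Ψ : ℝ × ℝ → ℂ) : ℝ := ∫ y, b4Integrand α Ψ y

/-- The quadratic form `a_{α,β,γ}`. -/
def aForm (α β : ℝ) (γ : ℂ) (Ψ : ℝ × ℝ → ℂ) : ℝ :=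
  if β = 0 then a0 Ψ + b4 α Ψ
  else a0 Ψ + (1 / β) * (b1 Ψ + b2 α β γ Ψ + b3 γ Ψ)

/-- The squared norm `‖Ψ‖²` of `L²(ℝ²)`. -/
def normSq (Ψ : ℝ × ℝ → ℂ) : ℝ := ∫ p, ‖Ψ p‖ ^ 2

/-- The number `|4 + αβ + |γ|²| + √((αβ + |γ|² - 4)² + 16 |γ|²)`. -/
def kappa (α β : ℝ) (γ : ℂ) : ℝ :=
  |4 + α * β + ‖γ‖ ^ 2| + √((α * β + ‖γ‖ ^ 2 - 4) ^ 2 + 16 * ‖γ‖ ^ 2)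

end SpectralTransition

end

/-! Everything reduces to one-dimensional inequalities on lines. On the horizontal line at height
`y`, put `s = |y|` and let `u` be the restriction of `Ψ` to one half-line. Integrating `(u²)' =
2uu'` from the axis to a far point where `u²` is small, and using `2s|uu'| ≤ √2(|u'|² + ½s²|u|²)`,
gives `s|u(0)|² ≤ √2 ∫ (|u'|² + ½s²|u|²)` (`HasWeakDeriv₁.exists_trace`). Integrated over `y`, this
bounds `∫ |y|(|Ψ(0+,y)|² + |Ψ(0-,y)|²)` by `√2 a₀`
(`integrable_and_abs_integral_le_of_trace_bound`).

The boundary density is `y` times a quadratic expression in `X = |Ψ(0+) - Ψ(0-)|` and `Y = |Ψ(0+) +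
Ψ(0-)|`. It is dominated by the form with matrix entries `1`, `|γ|/2`, `(αβ+|γ|²)/4`, whose spectral
radius is `κ/8` (`abs_quadratic_le`). Since `X² + Y² = 2(|Ψ(0+)|² + |Ψ(0-)|²)`, the final constant
is `2 · κ/8 · √2 = κ/(2√2)`. The bounds hold in absolute value, so the signs of `y`, `α` and `β`
play no role.

The `L²` bound comes from vertical lines, where the oscillator `-d²/dy² + y²` is at least `1`
(`HasWeakDeriv₁.integral_sq_le`).

The passage from the plane to lines rests on `ae_hasWeakDeriv₁_slice`: almost every slice of a
weakly differentiable function is weakly differentiable, hence almost everywhere a primitive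
(`HasWeakDeriv₁.ae_eq_primitive`). -/

namespace SpectralTransition

/-! ### Weak derivatives and primitives on an interval -/

section OneVariable

/-- `v` is the weak derivative of `u` on the set `I` of real numbers. -/
def HasWeakDeriv₁ (I : Set ℝ) (u v : ℝ → ℝ) : Prop :=
  ∀ φ : ℝ → ℝ, ContDiff ℝ ∞ φ → HasCompactSupport φ → tsupport φ ⊆ I →
    ∫ x in I, deriv φ x * u x = - ∫ x in I, φ x * v x

theorem locallyIntegrable_indicator_of_memLp {I : Set ℝ} (hI : MeasurableSet I) {v : ℝ → ℝ}
    (hv : MemLp v 2 (volume.restrict I)) : LocallyIntegrable (I.indicator v) :=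
  ((memLp_indicator_iff_restrict hI).2 hv).locallyIntegrable (by norm_num)

theorem intervalIntegrable_of_locallyIntegrable {v : ℝ → ℝ} (hv : LocallyIntegrable v)
    (a b : ℝ) : IntervalIntegrable v volume a b :=
  intervalIntegrable_iff.2 ((hv.integrableOn_isCompact isCompact_uIcc).mono_set uIoc_subset_uIcc)

theorem absolutelyContinuousOnInterval_primitive {v : ℝ → ℝ} (hv : LocallyIntegrable v)
    (a b : ℝ) : AbsolutelyContinuousOnInterval (fun x => ∫ t in (0 : ℝ)..x, v t) a b := by
  have hi : IntervalIntegrable v volume (min (min a b) 0) (max (max a b) 0) :=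
    intervalIntegrable_of_locallyIntegrable hv _ _
  have h0 : (0 : ℝ) ∈ uIcc (min (min a b) 0) (max (max a b) 0) := by
    rw [uIcc_of_le (by simp)]; simp
  refine (hi.absolutelyContinuousOnInterval_intervalIntegral h0).mono ?_
  rw [uIcc_of_le (a := min (min a b) 0) (by simp), uIcc]
  exact Icc_subset_Icc (by simp) (by simp)

theorem absolutelyContinuousOnInterval_const_add_primitive {v : ℝ → ℝ}
    (hv : LocallyIntegrable v) (c a b : ℝ) :
    AbsolutelyContinuousOnInterval (fun x => c + ∫ t in (0 : ℝ)..x, v t) a b := by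
  have h : AbsolutelyContinuousOnInterval (fun _ : ℝ => c) a b :=
    ContDiffOn.absolutelyContinuousOnInterval contDiffOn_const
  exact h.add (absolutelyContinuousOnInterval_primitive hv a b)

theorem ae_deriv_const_add_primitive {v : ℝ → ℝ} (hv : LocallyIntegrable v) (c : ℝ) :
    ∀ᵐ x, deriv (fun x => c + ∫ t in (0 : ℝ)..x, v t) x = v x := by
  filter_upwards [LocallyIntegrable.ae_hasDerivAt_integral hv] with x hx
  exact ((hx 0).const_add c).deriv

theorem continuous_const_add_primitive {v : ℝ → ℝ} (hv : LocallyIntegrable v) (c : ℝ) :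
    Continuous fun x => c + ∫ t in (0 : ℝ)..x, v t :=
  continuous_const.add (intervalIntegral.continuous_primitive
    (fun _ _ => intervalIntegrable_of_locallyIntegrable hv _ _) 0)

/-- Integration by parts of a `C¹` function against a primitive. -/
theorem integral_deriv_mul_primitive {v : ℝ → ℝ} (hv : LocallyIntegrable v) {φ : ℝ → ℝ}
    (hφ : ContDiff ℝ 1 φ) {a b : ℝ} (ha : φ a = 0) (hb : φ b = 0) :
    ∫ x in a..b, deriv φ x * (∫ t in (0 : ℝ)..x, v t) = - ∫ x in a..b, φ x * v x := by
  have h := AbsolutelyContinuousOnInterval.integral_mul_deriv_eq_deriv_mul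
    (hφ.contDiffOn.absolutelyContinuousOnInterval (a := a) (b := b))
    (absolutelyContinuousOnInterval_primitive hv a b)
  rw [ha, hb] at h
  have h2 : ∫ x in a..b, φ x * deriv (fun x => ∫ t in (0 : ℝ)..x, v t) x
      = ∫ x in a..b, φ x * v x := by
    apply intervalIntegral.integral_congr_ae
    filter_upwards [LocallyIntegrable.ae_hasDerivAt_integral hv] with x hx _
    rw [(hx 0).deriv]
  rw [h2] at h
  linarith

/-- A function on an open interval that has an integrable weak derivative is almost everywhere
a primitive of it. -/
theorem HasWeakDeriv₁.ae_eq_primitive {I : Set ℝ} (hI : IsOpen I) (hIc : I.OrdConnected)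
    {u v : ℝ → ℝ} (hu : MemLp u 2 (volume.restrict I)) (hv : MemLp v 2 (volume.restrict I))
    (h : HasWeakDeriv₁ I u v) :
    ∃ c, ∀ᵐ x, x ∈ I → u x = c + ∫ t in (0 : ℝ)..x, I.indicator v t := by
  rcases I.eq_empty_or_nonempty with rfl | ⟨x₀, hx₀⟩
  · exact ⟨0, by simp⟩
  have hvl := locallyIntegrable_indicator_of_memLp hI.measurableSet hv
  -- Extension of `v` by zero makes `0` a legitimate base point even when it is only a boundary
  -- point of `I`; the constant `c` is then the boundary value there.
  set V : ℝ → ℝ := fun x => ∫ t in (0 : ℝ)..x, I.indicator v t with hV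
  have hVc : Continuous V :=
    intervalIntegral.continuous_primitive (fun _ _ => intervalIntegrable_of_locallyIntegrable hvl _ _) 0
  have hul := locallyIntegrable_indicator_of_memLp hI.measurableSet hu
  obtain ⟨r, hr, hrI⟩ := Metric.isOpen_iff.1 hI x₀ hx₀
  let B : ContDiffBump x₀ := ⟨r / 4, r / 2, by positivity, by linarith⟩
  -- A fixed bump of integral one: subtracting a multiple of it turns any test function into one of
  -- zero mean (du Bois-Reymond).
  set ρ : ℝ → ℝ := B.normed volume with hρ
  have hρc : HasCompactSupport ρ := B.hasCompactSupport_normed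
  have hρs : ContDiff ℝ ∞ ρ := B.contDiff_normed
  have hρI : tsupport ρ ⊆ I := by
    rw [hρ, B.tsupport_normed_eq]
    exact (Metric.closedBall_subset_ball (by change r / 2 < r; linarith)).trans hrI
  have hρ1 : ∫ x, ρ x = 1 := B.integral_normed
  -- the test functions of zero mean
  have key : ∀ θ : ℝ → ℝ, ContDiff ℝ ∞ θ → HasCompactSupport θ → tsupport θ ⊆ I →
      ∫ x, θ x = 0 → ∫ x, θ x * (I.indicator u x - V x) = 0 := by
    intro θ hθ hθc hθI hθ0
    have hsupp : ∃ a b, a ≤ b ∧ Icc a b ⊆ I ∧ tsupport θ ⊆ Icc a b := by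
      rcases (tsupport θ).eq_empty_or_nonempty with h0 | hne
      · exact ⟨x₀, x₀, le_rfl, by simpa using hx₀, by simp [h0]⟩
      · obtain ⟨a, ha⟩ := hθc.isCompact.exists_isLeast hne
        obtain ⟨b, hb⟩ := hθc.isCompact.exists_isGreatest hne
        exact ⟨a, b, ha.2 hb.1, hIc.out (hθI ha.1) (hθI hb.1), fun x hx => ⟨ha.2 hx, hb.2 hx⟩⟩
    obtain ⟨a, b, hab, habI, hsub⟩ := hsupp
    have hz : ∀ x, x ∉ Icc a b → θ x = 0 := fun x hx =>
      image_eq_zero_of_notMem_tsupport fun h => hx (hsub h)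
    have hθi : Integrable θ := hθ.continuous.integrable_of_hasCompactSupport hθc
    -- The primitive of `θ` vanishes to the right of `b` exactly because `θ` has zero mean, so it is
    -- itself an admissible test function.
    set φ : ℝ → ℝ := fun x => ∫ t in a..x, θ t with hφ
    have hφd : ∀ x, HasDerivAt φ (θ x) x := fun x => hθ.continuous.integral_hasStrictDerivAt a x
      |>.hasDerivAt
    have hφderiv : deriv φ = θ := funext fun x => (hφd x).deriv
    have hφs : ContDiff ℝ ∞ φ := by
      rw [contDiff_infty_iff_deriv, hφderiv]
      exact ⟨fun x => (hφd x).differentiableAt, hθ⟩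
    have hIab : ∫ t in a..b, θ t = 0 := by
      rw [intervalIntegral.integral_of_le hab, ← integral_Icc_eq_integral_Ioc,
        setIntegral_eq_integral_of_forall_compl_eq_zero hz, hθ0]
    have hφz : ∀ x, x ∉ Icc a b → φ x = 0 := by
      intro x hx
      have hx' : x < a ∨ b < x := by
        by_contra hcon; push Not at hcon; exact hx hcon
      rcases hx' with hx' | hx'
      · apply intervalIntegral.integral_zero_ae
        filter_upwards [Measure.ae_ne volume a] with t ht1 ht
        rw [uIoc_of_ge hx'.le] at ht
        exact hz t fun hh => ht1 (le_antisymm ht.2 hh.1)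
      · have : φ x = (∫ t in a..b, θ t) + ∫ t in b..x, θ t :=
          (intervalIntegral.integral_add_adjacent_intervals
            hθi.intervalIntegrable hθi.intervalIntegrable).symm
        rw [this, hIab, zero_add]
        apply intervalIntegral.integral_zero_ae
        filter_upwards with t ht
        rw [uIoc_of_le hx'.le] at ht
        exact hz t fun hh => absurd ht.1 (not_lt.2 hh.2)
    have hφt : tsupport φ ⊆ Icc a b :=
      closure_minimal (fun x hx => by by_contra h; exact hx (hφz x h)) isClosed_Icc
    have hφc : HasCompactSupport φ := HasCompactSupport.of_support_subset_isCompact isCompact_Icc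
      (fun x hx => by by_contra h; exact hx (hφz x h))
    have e1 := h φ hφs hφc (hφt.trans habI)
    rw [hφderiv] at e1
    have e2 : ∫ x in I, θ x * u x = ∫ x, θ x * I.indicator u x := by
      rw [← integral_indicator hI.measurableSet]
      congr 1; ext x; by_cases hx : x ∈ I <;> simp [hx]
    have e3 : ∫ x in I, φ x * v x = ∫ x, φ x * I.indicator v x := by
      rw [← integral_indicator hI.measurableSet]
      congr 1; ext x; by_cases hx : x ∈ I <;> simp [hx]
    have e4 := integral_deriv_mul_primitive hvl (hφs.of_le (by simp)) (a := a) (b := b)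
      (by simp [hφ]) hIab
    rw [hφderiv, intervalIntegral.integral_of_le hab, ← integral_Icc_eq_integral_Ioc,
      setIntegral_eq_integral_of_forall_compl_eq_zero (fun x hx => by simp [hz x hx]),
      intervalIntegral.integral_of_le hab, ← integral_Icc_eq_integral_Ioc,
      setIntegral_eq_integral_of_forall_compl_eq_zero (fun x hx => by simp [hφz x hx])] at e4
    have i1 : Integrable fun x => θ x * I.indicator u x :=
      hul.integrable_smul_left_of_hasCompactSupport hθ.continuous hθc
    have i2 : Integrable fun x => θ x * V x :=
      (hθ.continuous.mul hVc).integrable_of_hasCompactSupport hθc.mul_right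
    simp_rw [mul_sub]
    rw [integral_sub i1 i2, ← e2, e1, e3, e4, sub_self]
  have hwl : LocallyIntegrable fun x => I.indicator u x - V x := hul.sub hVc.locallyIntegrable
  -- The constant must be the `ρ`-average of `u - V`: testing with `η - (∫η)ρ` then gives `∫ η(u - V
  -- - c) = 0` for every `η`.
  set c : ℝ := ∫ x, ρ x * (I.indicator u x - V x) with hc
  have hfin : ∀ᵐ x, x ∈ I → I.indicator u x - V x - c = 0 := by
    refine hI.ae_eq_zero_of_integral_contDiff_smul_eq_zero
      ((hwl.sub (locallyIntegrable_const c)).locallyIntegrableOn I) ?_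
    intro η hη hηc hηI
    set m := ∫ x, η x with hm
    have hmρc : HasCompactSupport fun x => m * ρ x := hρc.mul_left
    have hk := key (fun x => η x - m * ρ x) (hη.sub (contDiff_const.mul hρs))
      (hηc.sub hmρc) ?_ ?_
    · have i1 : Integrable fun x => η x * (I.indicator u x - V x) :=
        hwl.integrable_smul_left_of_hasCompactSupport hη.continuous hηc
      have i2 : Integrable fun x => ρ x * (I.indicator u x - V x) :=
        hwl.integrable_smul_left_of_hasCompactSupport hρs.continuous hρc
      have i3 : Integrable η := hη.continuous.integrable_of_hasCompactSupport hηc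
      have e1 : ∀ x, (η x - m * ρ x) * (I.indicator u x - V x)
          = η x * (I.indicator u x - V x) - m * (ρ x * (I.indicator u x - V x)) := by
        intro x; ring
      simp_rw [e1] at hk
      rw [integral_sub i1 (i2.const_mul m), integral_const_mul, ← hc] at hk
      simp_rw [smul_eq_mul]
      have e3 : ∀ x, η x * (I.indicator u x - V x - c)
          = η x * (I.indicator u x - V x) - η x * c := by
        intro x; ring
      simp_rw [e3]
      rw [integral_sub i1 (i3.mul_const c), integral_mul_const, ← hm]
      exact hk
    · refine (tsupport_sub _ _).trans (union_subset hηI ?_)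
      exact (tsupport_mul_subset_right (f := fun _ => m)).trans hρI
    · rw [integral_sub (hη.continuous.integrable_of_hasCompactSupport hηc)
        ((hρs.continuous.integrable_of_hasCompactSupport hρc).const_mul m), integral_const_mul,
        hρ1]
      simp [hm]
  refine ⟨c, ?_⟩
  filter_upwards [hfin] with x hx hxI
  have := hx hxI
  rw [indicator_of_mem hxI] at this
  linarith

end OneVariable

/-! ### Trace inequality on a half-line and the oscillator bound -/

section OneVariable

/-- A positive constant is not integrable over infinite measure. This yields far points with small
boundary terms, without proving any decay at infinity. -/
theorem IntegrableOn.exists_lt {f : ℝ → ℝ} {I : Set ℝ} (hIm : MeasurableSet I)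
    (hI : volume I = ⊤) (hf : IntegrableOn f I) {ε : ℝ} (hε : 0 < ε) : ∃ x ∈ I, f x < ε := by
  by_contra! hcon
  have h : IntegrableOn (fun _ : ℝ => ε) I := by
    refine Integrable.mono' hf aestronglyMeasurable_const ?_
    filter_upwards [ae_restrict_mem hIm] with x hx
    rw [Real.norm_of_nonneg hε.le]
    exact hcon x hx
  rw [integrableOn_const_iff] at h
  rcases h with h | h
  · exact hε.ne' (by simpa using h)
  · rw [hI] at h; exact lt_irrefl _ h

theorem integral_primitive_sq {v : ℝ → ℝ} (hv : LocallyIntegrable v) (c a b : ℝ) :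
    ∫ x in a..b, 2 * ((c + ∫ t in (0 : ℝ)..x, v t) * v x)
      = (c + ∫ t in (0 : ℝ)..b, v t) ^ 2 - (c + ∫ t in (0 : ℝ)..a, v t) ^ 2 := by
  have hU := absolutelyContinuousOnInterval_const_add_primitive hv c a b
  have h := hU.integral_deriv_mul_eq_sub hU
  rw [sq, sq, ← h]
  apply intervalIntegral.integral_congr_ae
  filter_upwards [ae_deriv_const_add_primitive hv c] with x hx _
  rw [hx]; ring

/-- The boundary value at `0` of a function on a half-line with a square-integrable derivative. -/
theorem HasWeakDeriv₁.exists_trace {I : Set ℝ} (hI : IsOpen I) (hIc : I.OrdConnected)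
    (hIv : volume I = ⊤) (hI0 : ∀ x ∈ I, ∀ t ∈ uIcc 0 x, t ≠ 0 → t ∈ I)
    {u v : ℝ → ℝ} (hu : MemLp u 2 (volume.restrict I)) (hv : MemLp v 2 (volume.restrict I))
    (h : HasWeakDeriv₁ I u v) :
    ∃ c, Tendsto u (𝓝[I] 0 ⊓ ae volume) (𝓝 c) ∧
      ∀ s : ℝ, 0 ≤ s → s * c ^ 2 ≤ √2 * ∫ x in I, (v x ^ 2 + 1 / 2 * s ^ 2 * u x ^ 2) := by
  obtain ⟨c, hc⟩ := h.ae_eq_primitive hI hIc hu hv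
  have hvl := locallyIntegrable_indicator_of_memLp hI.measurableSet hv
  set U : ℝ → ℝ := fun x => c + ∫ t in (0 : ℝ)..x, I.indicator v t with hU
  have hUc : Continuous U := continuous_const_add_primitive hvl c
  have hU0 : U 0 = c := by simp [hU]
  have hc' : ∀ᵐ x ∂(volume.restrict I), u x = U x := (ae_restrict_iff' hI.measurableSet).2 hc
  refine ⟨c, ?_, fun s hs => ?_⟩
  · have h1 : Tendsto U (𝓝[I] 0 ⊓ ae volume) (𝓝 c) := by
      have := hUc.tendsto 0
      rw [hU0] at this
      exact this.mono_left (inf_le_left.trans nhdsWithin_le_nhds)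
    refine h1.congr' ?_
    have h2 : ∀ᶠ x in 𝓝[I] 0 ⊓ ae volume, x ∈ I := mem_inf_of_left self_mem_nhdsWithin
    have h3 : ∀ᶠ x in 𝓝[I] 0 ⊓ ae volume, x ∈ I → u x = U x := mem_inf_of_right hc
    filter_upwards [h2, h3] with x hx hx'
    exact (hx' hx).symm
  have hu2 : IntegrableOn (fun x => u x ^ 2) I := hu.integrable_sq
  have hv2 : IntegrableOn (fun x => v x ^ 2) I := hv.integrable_sq
  have hU2 : IntegrableOn (fun x => s * U x ^ 2) I := by
    refine (hu2.const_mul s).congr ?_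
    filter_upwards [hc'] with x hx
    rw [hx]
  have hM : IntegrableOn (fun x => √2 * (v x ^ 2 + 1 / 2 * s ^ 2 * u x ^ 2)) I :=
    (hv2.add (hu2.const_mul _)).const_mul _
  rw [← integral_const_mul]
  have hbound : ∀ x ∈ I, s * c ^ 2 ≤ s * U x ^ 2 +
      ∫ x in I, √2 * (v x ^ 2 + 1 / 2 * s ^ 2 * u x ^ 2) := by
    intro x hx
    have e := integral_primitive_sq hvl c 0 x
    rw [intervalIntegral.integral_same, add_zero] at e
    -- Only almost everywhere: for the left half-line the interval contains its endpoint `0`, which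
    -- is not in `I`.
    have hsub : ∀ᵐ t : ℝ, t ∈ uIoc 0 x → t ∈ I := by
      filter_upwards [Measure.ae_ne volume 0] with t ht h
      exact hI0 x hx t (uIoc_subset_uIcc h) ht
    have hs1 : s * c ^ 2 - s * U x ^ 2 =
        - ∫ t in (0 : ℝ)..x, s * (2 * (U t * I.indicator v t)) := by
      rw [intervalIntegral.integral_const_mul, e]; ring
    have hle : |∫ t in (0 : ℝ)..x, s * (2 * (U t * I.indicator v t))|
        ≤ ∫ x in I, √2 * (v x ^ 2 + 1 / 2 * s ^ 2 * u x ^ 2) := by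
      rw [intervalIntegral.abs_intervalIntegral_eq]
      have hM' : IntegrableOn (fun x => √2 * (v x ^ 2 + 1 / 2 * s ^ 2 * u x ^ 2)) (uIoc 0 x) :=
        hM.mono_set_ae hsub
      rw [← Real.norm_eq_abs]
      refine (norm_integral_le_of_norm_le hM' ?_).trans (setIntegral_mono_set hM ?_ hsub)
      · rw [ae_restrict_iff' measurableSet_uIoc]
        filter_upwards [hsub, hc] with t ht htc htx
        rw [indicator_of_mem (ht htx)]
        rw [show U t = u t from (htc (ht htx)).symm]
        -- The squares `√2 (v ∓ (√2/2) s u)² ≥ 0` give `± 2suv ≤ √2 (v² + ½s²u²)`.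
        have h2 : (√2) ^ 2 = 2 := Real.sq_sqrt (by norm_num)
        have h2p : 0 < √2 := by positivity
        have hk1 := mul_nonneg h2p.le (sq_nonneg (v t - √2 / 2 * (s * u t)))
        have hk2 := mul_nonneg h2p.le (sq_nonneg (v t + √2 / 2 * (s * u t)))
        have e1 : √2 * (v t - √2 / 2 * (s * u t)) ^ 2
            = √2 * (v t ^ 2 + (√2) ^ 2 / 4 * s ^ 2 * u t ^ 2) - (√2) ^ 2 * (s * u t * v t) := by
          ring
        have e2 : √2 * (v t + √2 / 2 * (s * u t)) ^ 2
            = √2 * (v t ^ 2 + (√2) ^ 2 / 4 * s ^ 2 * u t ^ 2) + (√2) ^ 2 * (s * u t * v t) := by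
          ring
        rw [e1, h2] at hk1
        rw [e2, h2] at hk2
        rw [Real.norm_eq_abs, abs_le]
        constructor <;> linarith
      · filter_upwards with t
        simp only [Pi.zero_apply]; positivity
    have := neg_le_abs (∫ t in (0 : ℝ)..x, s * (2 * (U t * I.indicator v t)))
    linarith
  refine le_of_forall_pos_le_add fun ε hε => ?_
  obtain ⟨x, hx, hlt⟩ := IntegrableOn.exists_lt hI.measurableSet hIv hU2 hε
  have := hbound x hx
  linarith

/-- The lower bound `1` of the harmonic oscillator `-d²/dy² + y²`. -/
theorem HasWeakDeriv₁.integral_sq_le {u v : ℝ → ℝ} (hu : MemLp u 2) (hv : MemLp v 2)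
    (hyu : Integrable fun y => y ^ 2 * u y ^ 2) (h : HasWeakDeriv₁ univ u v) :
    ∫ y, u y ^ 2 ≤ ∫ y, (v y ^ 2 + y ^ 2 * u y ^ 2) := by
  obtain ⟨c, hc⟩ := h.ae_eq_primitive isOpen_univ ordConnected_univ (by simpa using hu)
    (by simpa using hv)
  simp only [mem_univ, forall_const, indicator_univ] at hc
  have hvl : LocallyIntegrable v := hv.locallyIntegrable (by norm_num)
  set U : ℝ → ℝ := fun x => c + ∫ t in (0 : ℝ)..x, v t with hU
  have hu2 : Integrable fun y => u y ^ 2 := hu.integrable_sq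
  have hv2 : Integrable fun y => v y ^ 2 := hv.integrable_sq
  have hM : Integrable fun y => v y ^ 2 + y ^ 2 * u y ^ 2 := hv2.add hyu
  have hw : Integrable fun y => y ^ 2 * U y ^ 2 := by
    refine hyu.congr ?_
    filter_upwards [hc] with y hy
    rw [hy]
  -- Symmetrized so that a single radius `R` makes the boundary terms at `R` and at `-R` small
  -- together.
  have hw' : Integrable fun y => y ^ 2 * U y ^ 2 + y ^ 2 * U (-y) ^ 2 := by
    refine hw.add ?_
    simpa using hw.comp_neg
  have hyv : Integrable fun y => 2 * (y * u y) * v y := by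
    have hyu' : MemLp (fun y => 2 * (y * u y)) 2 := by
      refine MemLp.const_mul ?_ 2
      rw [memLp_two_iff_integrable_sq]
      · simpa [mul_pow] using hyu
      · exact aestronglyMeasurable_id.mul hu.1
    exact hyu'.integrable_mul hv
  -- Integration of `(yU²)' = U² + 2yUU'`, with `yU²` treated as the product of `yU` and `U`. The
  -- last term is then absorbed by `-2yuv ≤ v² + y²u²`.
  have hR : ∀ R : ℝ, ∫ y in (-R)..R, u y ^ 2 =
      R * (U R ^ 2 + U (-R) ^ 2) - ∫ y in (-R)..R, 2 * (y * u y) * v y := by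
    intro R
    have hUac := absolutelyContinuousOnInterval_const_add_primitive hvl c (-R) R
    have hid : AbsolutelyContinuousOnInterval (fun y : ℝ => y) (-R) R :=
      ContDiffOn.absolutelyContinuousOnInterval contDiffOn_id
    have e := (hid.fun_mul hUac).integral_deriv_mul_eq_sub hUac
    have e2 : (∫ y in (-R)..R, u y ^ 2) + ∫ y in (-R)..R, 2 * (y * u y) * v y
        = R * (U R ^ 2 + U (-R) ^ 2) := by
      rw [← intervalIntegral.integral_add hu2.intervalIntegrable hyv.intervalIntegrable]
      have : R * (U R ^ 2 + U (-R) ^ 2) = R * U R * U R - -R * U (-R) * U (-R) := by ring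
      rw [this, ← e]
      apply intervalIntegral.integral_congr_ae
      filter_upwards [LocallyIntegrable.ae_hasDerivAt_integral hvl, hc] with y hy hcy _
      have d : HasDerivAt U (v y) y := (hy 0).const_add c
      rw [d.deriv, ((hasDerivAt_id' y).fun_mul d).deriv, hcy]
      ring
    linarith
  have hn : ∀ n : ℕ, ∫ y in (-(n : ℝ))..n, u y ^ 2 ≤ ∫ y, (v y ^ 2 + y ^ 2 * u y ^ 2) := by
    intro n
    refine le_of_forall_pos_le_add fun ε hε => ?_
    -- Beyond `n + 1` rather than `n`, so that `R ≥ 1` and the boundary factor `R` is at most the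
    -- controlled weight `R²`.
    obtain ⟨R, hRn, hRε⟩ := IntegrableOn.exists_lt (I := Ioi ((n : ℝ) + 1)) measurableSet_Ioi
      (by simp) hw'.integrableOn hε
    have hRn' : (n : ℝ) + 1 < R := hRn
    have hn0 : (0 : ℝ) ≤ n := n.cast_nonneg
    have h1 : ∫ y in (-(n : ℝ))..n, u y ^ 2 ≤ ∫ y in (-R)..R, u y ^ 2 := by
      refine intervalIntegral.integral_mono_interval (by linarith) (by linarith) (by linarith) ?_
        hu2.intervalIntegrable
      filter_upwards with y
      exact sq_nonneg _
    have h2 : - ∫ y in (-R)..R, 2 * (y * u y) * v y ≤ ∫ y, (v y ^ 2 + y ^ 2 * u y ^ 2) := by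
      rw [intervalIntegral.integral_of_le (by linarith), ← integral_neg]
      calc _ ≤ ∫ y in Ioc (-R) R, (v y ^ 2 + y ^ 2 * u y ^ 2) := by
            refine integral_mono hyv.integrableOn.neg hM.integrableOn fun y => ?_
            nlinarith [sq_nonneg (v y + y * u y)]
        _ ≤ _ := setIntegral_le_integral hM (by filter_upwards with y; positivity)
    rw [hR R] at h1
    have h3 : R * (U R ^ 2 + U (-R) ^ 2) ≤ R ^ 2 * U R ^ 2 + R ^ 2 * U (-R) ^ 2 := by
      have : R ≤ R ^ 2 := by nlinarith
      rw [← mul_add]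
      gcongr
    linarith
  have ht := intervalIntegral_tendsto_integral hu2
    (tendsto_neg_atTop_atBot.comp tendsto_natCast_atTop_atTop)
    (tendsto_natCast_atTop_atTop (R := ℝ))
  exact le_of_tendsto' ht hn

end OneVariable

/-! ### Weak differentiability of almost every slice -/

section Slices

theorem memLp_two_of_contDiff {φ : ℝ → ℝ} (hφ : ContDiff ℝ ∞ φ) (hφc : HasCompactSupport φ)
    (μ : Measure ℝ) [IsFiniteMeasureOnCompacts μ] : MemLp φ 2 μ :=
  hφ.continuous.memLp_of_hasCompactSupport hφc

/-- It suffices to test weak derivatives in `L²` with countably many functions. -/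
theorem exists_countable_test (I : Set ℝ) :
    ∃ S : Set (ℝ → ℝ), S.Countable ∧
      (∀ φ ∈ S, ContDiff ℝ ∞ φ ∧ HasCompactSupport φ ∧ tsupport φ ⊆ I) ∧
      ∀ u v : ℝ → ℝ, MemLp u 2 (volume.restrict I) → MemLp v 2 (volume.restrict I) →
        (∀ φ ∈ S, ∫ x in I, deriv φ x * u x = - ∫ x in I, φ x * v x) → HasWeakDeriv₁ I u v := by
  let T : Set (ℝ → ℝ) := {φ | ContDiff ℝ ∞ φ ∧ HasCompactSupport φ ∧ tsupport φ ⊆ I}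
  have hd : ∀ φ : T, ContDiff ℝ ∞ (deriv φ.1) := fun φ => (contDiff_infty_iff_deriv.1 φ.2.1).2
  -- The test identity is continuous in the pair `(φ, φ')` for the `L²` norm, and a subset of a
  -- separable metric space has a countable dense subset.
  let e : T → Lp ℝ 2 (volume.restrict I) × Lp ℝ 2 (volume.restrict I) := fun φ =>
    ((memLp_two_of_contDiff φ.2.1 φ.2.2.1 _).toLp _,
      (memLp_two_of_contDiff (hd φ) φ.2.2.1.deriv _).toLp _)
  have : Fact ((2 : ENNReal) ≠ ⊤) := ⟨by norm_num⟩
  obtain ⟨t, htS, htc, htd⟩ :=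
    (TopologicalSpace.IsSeparable.of_separableSpace (range e)).exists_countable_dense_subset
  choose ψ hψ using htS
  have := htc.to_subtype
  refine ⟨range fun z : t => (ψ z.2).1, countable_range _, ?_,
    fun u v hu hv h φ hφ hφc hφI => ?_⟩
  · rintro _ ⟨z, rfl⟩
    exact (ψ z.2).2
  let L : Lp ℝ 2 (volume.restrict I) × Lp ℝ 2 (volume.restrict I) → ℝ := fun z =>
    inner ℝ (hu.toLp u) z.2 + inner ℝ (hv.toLp v) z.1
  have hL : Continuous L := by fun_prop
  have hLe : ∀ φ : T, L (e φ) = (∫ x in I, deriv φ.1 x * u x) + ∫ x in I, φ.1 x * v x := by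
    intro φ
    simp only [L, e, L2.inner_def]
    congr 1
    · apply integral_congr_ae
      filter_upwards [hu.coeFn_toLp,
        (memLp_two_of_contDiff (hd φ) φ.2.2.1.deriv (volume.restrict I)).coeFn_toLp] with x h1 h2
      rw [h1, h2]; simp
    · apply integral_congr_ae
      filter_upwards [hv.coeFn_toLp,
        (memLp_two_of_contDiff φ.2.1 φ.2.2.1 (volume.restrict I)).coeFn_toLp] with x h1 h2
      rw [h1, h2]; simp
  have hcl : closure t ⊆ {z | L z = 0} := by
    refine closure_minimal (fun z hz => ?_) (isClosed_eq hL continuous_const)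
    have := h _ ⟨⟨z, hz⟩, rfl⟩
    rw [mem_ofPred_eq, ← hψ hz, hLe, this]
    simp
  have : L (e ⟨φ, hφ, hφc, hφI⟩) = 0 := hcl (htd (mem_range_self _))
  rw [hLe] at this
  exact eq_neg_of_add_eq_zero_left this

theorem ae_memLp_slice {μ ν : Measure ℝ} [SFinite μ] [SFinite ν] {f : ℝ × ℝ → ℝ}
    (hf : MemLp f 2 (μ.prod ν)) : ∀ᵐ y ∂ν, MemLp (fun x => f (x, y)) 2 μ := by
  have h1 : ∀ᵐ y ∂ν, AEStronglyMeasurable (fun x => f (x, y)) μ := hf.1.prodMk_right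
  have h2 := hf.integrable_sq.prod_left_ae
  filter_upwards [h1, h2] with y h1 h2
  rw [memLp_two_iff_integrable_sq h1]
  exact h2

/-- A function of two variables whose weak derivative in the first variable is `g` has
weakly differentiable slices. -/
theorem ae_hasWeakDeriv₁_slice {I J : Set ℝ} (hJ : IsOpen J) {f g : ℝ × ℝ → ℝ}
    (hf : MemLp f 2 ((volume.restrict I).prod (volume.restrict J)))
    (hg : MemLp g 2 ((volume.restrict I).prod (volume.restrict J)))
    (h : ∀ φ ψ : ℝ → ℝ, ContDiff ℝ ∞ φ → HasCompactSupport φ → tsupport φ ⊆ I →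
      ContDiff ℝ ∞ ψ → HasCompactSupport ψ → tsupport ψ ⊆ J →
      ∫ p, deriv φ p.1 * ψ p.2 * f p ∂((volume.restrict I).prod (volume.restrict J)) =
        - ∫ p, φ p.1 * ψ p.2 * g p ∂((volume.restrict I).prod (volume.restrict J))) :
    ∀ᵐ y ∂(volume.restrict J), HasWeakDeriv₁ I (fun x => f (x, y)) (fun x => g (x, y)) := by
  obtain ⟨S, hSc, hS, hSt⟩ := exists_countable_test I
  -- products of a square-integrable function with a tensor product are integrable
  have hint : ∀ (a b : ℝ → ℝ) (k : ℝ × ℝ → ℝ),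
      MemLp k 2 ((volume.restrict I).prod (volume.restrict J)) →
      MemLp a 2 (volume.restrict I) → MemLp b 2 (volume.restrict J) →
      Integrable (fun p => a p.1 * b p.2 * k p)
        ((volume.restrict I).prod (volume.restrict J)) := by
    intro a b k hk ha hb
    have hab : MemLp (fun p : ℝ × ℝ => a p.1 * b p.2) 2
        ((volume.restrict I).prod (volume.restrict J)) := by
      refine (memLp_two_iff_integrable_sq (ha.1.comp_fst.mul hb.1.comp_snd)).2 ?_
      simpa [mul_pow] using ha.integrable_sq.mul_prod hb.integrable_sq
    exact hab.integrable_mul hk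
  have key : ∀ φ ∈ S, ∀ᵐ y ∂(volume.restrict J),
      ∫ x in I, deriv φ x * f (x, y) = - ∫ x in I, φ x * g (x, y) := by
    intro φ hφ
    obtain ⟨hφs, hφc, hφI⟩ := hS φ hφ
    have hφ2 := memLp_two_of_contDiff hφs hφc (volume.restrict I)
    have hφd2 := memLp_two_of_contDiff (contDiff_infty_iff_deriv.1 hφs).2 hφc.deriv
      (volume.restrict I)
    -- The defect of the test identity on the slice at height `y`. By Fubini, its integral against
    -- any `ψ` is the planar identity for `φ ⊗ ψ`, so it vanishes almost everywhere.
    set K : ℝ → ℝ := fun y => ∫ x in I, (deriv φ x * f (x, y) + φ x * g (x, y)) with hK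
    have hKint : ∀ b : ℝ → ℝ, MemLp b 2 (volume.restrict J) →
        Integrable (fun y => b y * K y) (volume.restrict J) ∧
        ∫ y in J, b y * K y =
          (∫ p, deriv φ p.1 * b p.2 * f p ∂((volume.restrict I).prod (volume.restrict J))) +
          ∫ p, φ p.1 * b p.2 * g p ∂((volume.restrict I).prod (volume.restrict J)) := by
      intro b hb
      have i1 := hint _ b f hf hφd2 hb
      have i2 := hint _ b g hg hφ2 hb
      have e : ∀ y, b y * K y = ∫ x in I, (deriv φ x * b y * f (x, y) + φ x * b y * g (x, y)) := by
        intro y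
        rw [hK, ← integral_const_mul]
        congr 1; ext x; ring
      simp_rw [e]
      exact ⟨(i1.add i2).integral_prod_right, by
        exact (integral_prod_symm _ (i1.add i2)).symm.trans (integral_add i1 i2)⟩
    -- Integrability of `K` over a compact set follows by taking its indicator for the weight `b`.
    have hKl : LocallyIntegrableOn K J := by
      rw [locallyIntegrableOn_iff hJ.isLocallyClosed]
      intro k hkJ hk
      have hb : MemLp (k.indicator fun _ => (1 : ℝ)) 2 (volume.restrict J) :=
        memLp_indicator_const 2 hk.measurableSet 1
          (Or.inr ((Measure.restrict_apply_le _ _).trans_lt hk.measure_lt_top).ne)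
      have := (hKint _ hb).1
      have h2 : (fun y => k.indicator (fun _ => (1 : ℝ)) y * K y) = k.indicator K := by
        ext y; by_cases hy : y ∈ k <;> simp [hy]
      rw [h2, integrable_indicator_iff hk.measurableSet, IntegrableOn,
        Measure.restrict_restrict_of_subset hkJ] at this
      exact this
    have hK0 : ∀ᵐ y, y ∈ J → K y = 0 := by
      refine hJ.ae_eq_zero_of_integral_contDiff_smul_eq_zero hKl ?_
      intro ψ hψ hψc hψJ
      have e1 := (hKint ψ (memLp_two_of_contDiff hψ hψc _)).2
      rw [h φ ψ hφs hφc hφI hψ hψc hψJ, neg_add_cancel] at e1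
      rw [← e1]
      simp_rw [smul_eq_mul]
      refine (setIntegral_eq_integral_of_forall_compl_eq_zero fun y hy => ?_).symm
      rw [image_eq_zero_of_notMem_tsupport fun hh => hy (hψJ hh), zero_mul]
    rw [← ae_restrict_iff' hJ.measurableSet] at hK0
    filter_upwards [hK0, ae_memLp_slice hf, ae_memLp_slice hg] with y hy hfy hgy
    rw [hK] at hy
    have j1 : Integrable (fun x => deriv φ x * f (x, y)) (volume.restrict I) :=
      hφd2.integrable_mul hfy
    have j2 : Integrable (fun x => φ x * g (x, y)) (volume.restrict I) := hφ2.integrable_mul hgy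
    simp only at hy
    rw [integral_add j1 j2] at hy
    linarith
  -- Countability of `S` allows one null set of heights for all test functions.
  have hall := (ae_ball_iff hSc).2 key
  filter_upwards [hall, ae_memLp_slice hf, ae_memLp_slice hg] with y hy hfy hgy
  exact hSt _ _ hfy hgy hy

end Slices

/-! ### From planar weak derivatives to slices, and measurability of traces -/

section Plane

theorem volume_restrict_prod (I J : Set ℝ) :
    (volume : Measure (ℝ × ℝ)).restrict (I ×ˢ J)
      = (volume.restrict I).prod (volume.restrict J) := by
  rw [Measure.prod_restrict, Measure.volume_eq_prod]

theorem contDiff_tensor {φ ψ : ℝ → ℝ} (hφ : ContDiff ℝ ∞ φ) (hψ : ContDiff ℝ ∞ ψ) :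
    ContDiff ℝ ∞ fun p : ℝ × ℝ => φ p.1 * ψ p.2 :=
  (hφ.comp contDiff_fst).mul (hψ.comp contDiff_snd)

theorem tsupport_tensor_subset (φ ψ : ℝ → ℝ) :
    tsupport (fun p : ℝ × ℝ => φ p.1 * ψ p.2) ⊆ tsupport φ ×ˢ tsupport ψ := by
  refine closure_minimal (fun p hp => ?_)
    ((isClosed_tsupport φ).prod (isClosed_tsupport ψ))
  exact ⟨subset_tsupport _ (left_ne_zero_of_mul hp), subset_tsupport _ (right_ne_zero_of_mul hp)⟩

theorem hasCompactSupport_tensor {φ ψ : ℝ → ℝ} (hφ : HasCompactSupport φ)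
    (hψ : HasCompactSupport ψ) : HasCompactSupport fun p : ℝ × ℝ => φ p.1 * ψ p.2 :=
  (hφ.isCompact.prod hψ.isCompact).of_isClosed_subset (isClosed_tsupport _)
    (tsupport_tensor_subset φ ψ)

theorem fderiv_tensor {φ ψ : ℝ → ℝ} (hφ : ContDiff ℝ ∞ φ) (hψ : ContDiff ℝ ∞ ψ)
    (p v : ℝ × ℝ) : fderiv ℝ (fun p : ℝ × ℝ => φ p.1 * ψ p.2) p v
      = v.1 * (deriv φ p.1 * ψ p.2) + v.2 * (φ p.1 * deriv ψ p.2) := by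
  have h1 : HasDerivAt φ (deriv φ p.1) p.1 := (hφ.differentiable (by simp) _).hasDerivAt
  have h2 : HasDerivAt ψ (deriv ψ p.2) p.2 := (hψ.differentiable (by simp) _).hasDerivAt
  have h := (h1.comp_hasFDerivAt p (ContinuousLinearMap.fst ℝ ℝ ℝ).hasFDerivAt).mul
    (h2.comp_hasFDerivAt p (ContinuousLinearMap.snd ℝ ℝ ℝ).hasFDerivAt)
  have h' : HasFDerivAt (fun p : ℝ × ℝ => φ p.1 * ψ p.2) _ p := h
  rw [h'.fderiv]
  simp only [Function.comp_apply, _root_.add_apply, _root_.smul_apply,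
    ContinuousLinearMap.coe_fst', ContinuousLinearMap.coe_snd', smul_eq_mul]
  ring

/-- Reduces complex-valued weak derivatives to real ones; `T` will be the real or the imaginary
part. -/
theorem integral_smul_clm {Ω : Set (ℝ × ℝ)} {f : ℝ × ℝ → ℂ} (hf : MemLp f 2 (volume.restrict Ω))
    {a : ℝ × ℝ → ℝ} (ha : Continuous a) (hac : HasCompactSupport a) (T : ℂ →L[ℝ] ℝ) :
    ∫ p in Ω, a p * T (f p) = T (∫ p in Ω, a p • f p) := by
  have ha2 : MemLp a 2 (volume.restrict Ω) := ha.memLp_of_hasCompactSupport hac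
  have hi : Integrable (fun p => a p • f p) (volume.restrict Ω) := by
    refine memLp_one_iff_integrable.1 (MemLp.smul (p := 2) (q := 2) hf ha2)
  rw [← T.integral_comp_comm hi]
  simp only [map_smul, smul_eq_mul]

/-- The real components of a weakly differentiable function, tested with tensor products. -/
theorem HasWeakDeriv.tensor {I J : Set ℝ} {v : ℝ × ℝ} {f g : ℝ × ℝ → ℂ}
    (h : HasWeakDeriv (I ×ˢ J) v f g) (hf : MemLp f 2 (volume.restrict (I ×ˢ J)))
    (hg : MemLp g 2 (volume.restrict (I ×ˢ J))) (T : ℂ →L[ℝ] ℝ) {φ ψ : ℝ → ℝ}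
    (hφ : ContDiff ℝ ∞ φ) (hφc : HasCompactSupport φ) (hφI : tsupport φ ⊆ I)
    (hψ : ContDiff ℝ ∞ ψ) (hψc : HasCompactSupport ψ) (hψJ : tsupport ψ ⊆ J) :
    ∫ p in I ×ˢ J, (v.1 * (deriv φ p.1 * ψ p.2) + v.2 * (φ p.1 * deriv ψ p.2)) * T (f p)
      = - ∫ p in I ×ˢ J, (φ p.1 * ψ p.2) * T (g p) := by
  have hs := contDiff_tensor hφ hψ
  have hc := hasCompactSupport_tensor hφc hψc
  have e := h.2.2 _ hs hc ((tsupport_tensor_subset φ ψ).trans (prod_mono hφI hψJ))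
  rw [integral_smul_clm hg hs.continuous hc]
  have hd : Continuous fun p => fderiv ℝ (fun p : ℝ × ℝ => φ p.1 * ψ p.2) p v :=
    (hs.continuous_fderiv (by simp)).clm_apply continuous_const
  have hdc : HasCompactSupport fun p => fderiv ℝ (fun p : ℝ × ℝ => φ p.1 * ψ p.2) p v :=
    hc.fderiv_apply ℝ v
  simp_rw [← fderiv_tensor hφ hψ]
  rw [integral_smul_clm hf hd hdc, e, map_neg]

theorem MemLp.clm_comp_real {α : Type*} [MeasurableSpace α] {μ : Measure α} {f : α → ℂ}
    (hf : MemLp f 2 μ) (T : ℂ →L[ℝ] ℝ) : MemLp (fun p => T (f p)) 2 μ :=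
  T.comp_memLp' hf

theorem HasWeakDeriv.ae_slice_fst {I J : Set ℝ} (hJ : IsOpen J) {f g : ℝ × ℝ → ℂ}
    (h : HasWeakDeriv (I ×ˢ J) ex f g) (hf : MemLp f 2 (volume.restrict (I ×ˢ J)))
    (hg : MemLp g 2 (volume.restrict (I ×ˢ J))) (T : ℂ →L[ℝ] ℝ) :
    ∀ᵐ y ∂(volume.restrict J),
      HasWeakDeriv₁ I (fun x => T (f (x, y))) (fun x => T (g (x, y))) := by
  refine ae_hasWeakDeriv₁_slice (f := fun p => T (f p)) (g := fun p => T (g p)) hJ ?_ ?_ ?_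
  · rw [← volume_restrict_prod]; exact MemLp.clm_comp_real hf T
  · rw [← volume_restrict_prod]; exact MemLp.clm_comp_real hg T
  · intro φ ψ hφ hφc hφI hψ hψc hψJ
    have := h.tensor hf hg T hφ hφc hφI hψ hψc hψJ
    simpa [ex, volume_restrict_prod] using this

theorem HasWeakDeriv.ae_slice_snd {I J : Set ℝ} (hI : IsOpen I) {f g : ℝ × ℝ → ℂ}
    (h : HasWeakDeriv (I ×ˢ J) ey f g) (hf : MemLp f 2 (volume.restrict (I ×ˢ J)))
    (hg : MemLp g 2 (volume.restrict (I ×ˢ J))) (T : ℂ →L[ℝ] ℝ) :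
    ∀ᵐ x ∂(volume.restrict I),
      HasWeakDeriv₁ J (fun y => T (f (x, y))) (fun y => T (g (x, y))) := by
  refine ae_hasWeakDeriv₁_slice (f := fun p => T (f p.swap)) (g := fun p => T (g p.swap))
    hI ?_ ?_ ?_
  · rw [volume_restrict_prod] at hf
    exact (MemLp.clm_comp_real hf T).comp_measurePreserving Measure.measurePreserving_swap
  · rw [volume_restrict_prod] at hg
    exact (MemLp.clm_comp_real hg T).comp_measurePreserving Measure.measurePreserving_swap
  · intro φ ψ hφ hφc hφJ hψ hψc hψI
    have := h.tensor hf hg T hψ hψc hψI hφ hφc hφJ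
    rw [volume_restrict_prod] at this
    simp only [ey, zero_mul, one_mul, zero_add] at this
    rw [← integral_prod_swap fun p => ψ p.1 * deriv φ p.2 * T (f p),
      ← integral_prod_swap fun p => ψ p.1 * φ p.2 * T (g p)] at this
    simpa only [Prod.fst_swap, Prod.snd_swap, mul_comm (ψ _)] using this

/-- The boundary value of a measurable function along almost every horizontal line is
measurable. -/
theorem aestronglyMeasurable_of_tendsto_slice {I : Set ℝ} (hI : IsOpen I)
    (h0 : (0 : ℝ) ∈ closure I) {f : ℝ × ℝ → ℂ} (hf : MemLp f 2 (volume.restrict (I ×ˢ univ)))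
    {r : ℝ → ℂ} (hr : ∀ᵐ y, Tendsto (fun x => f (x, y)) (𝓝[I] 0 ⊓ ae volume) (𝓝 (r y))) :
    AEStronglyMeasurable r := by
  have hf1 := hf.1
  rw [volume_restrict_prod, Measure.restrict_univ] at hf
  have := hI.measurableSet.nhdsWithin_isMeasurablyGenerated (0 : ℝ)
  -- Averages over these shrinking sets are measurable in `y` by Fubini, whereas a limit along an
  -- uncountable filter need not be visibly so.
  set s : ℕ → Set ℝ := fun n => I ∩ Metric.ball 0 (1 / ((n : ℝ) + 1)) with hs
  have hpos : ∀ n : ℕ, (0 : ℝ) < 1 / ((n : ℝ) + 1) := fun n => by positivity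
  have hso : ∀ n, IsOpen (s n) := fun n => hI.inter Metric.isOpen_ball
  have hsf : ∀ n, volume (s n) < ⊤ := fun n =>
    (measure_mono inter_subset_right).trans_lt measure_ball_lt_top
  have hsp : ∀ n, 0 < volume.real (s n) := by
    intro n
    refine ENNReal.toReal_pos (((hso n).measure_pos volume ?_).ne') (hsf n).ne
    obtain ⟨x, hx, hxI⟩ := mem_closure_iff.1 h0 _ Metric.isOpen_ball
      (Metric.mem_ball_self (hpos n))
    exact ⟨x, hxI, hx⟩
  have hst : Tendsto s atTop (𝓝[I] (0 : ℝ)).smallSets := by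
    rw [tendsto_smallSets_iff]
    intro t ht
    obtain ⟨ε, hε, hεt⟩ := Metric.mem_nhdsWithin_iff.1 ht
    have := tendsto_one_div_add_atTop_nhds_zero_nat (𝕜 := ℝ)
    filter_upwards [this.eventually (gt_mem_nhds hε)] with n hn
    exact fun x hx => hεt ⟨Metric.ball_subset_ball hn.le hx.2, hx.1⟩
  refine aestronglyMeasurable_of_tendsto_ae atTop
    (f := fun n y => (volume.real (s n))⁻¹ • ∫ x in s n, f (x, y)) (fun n => ?_) ?_
  · have h1 : AEStronglyMeasurable f ((volume.restrict (s n)).prod volume) := by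
      have := hf1.mono_measure (Measure.restrict_mono
        (prod_mono_left (inter_subset_left : s n ⊆ I)) le_rfl)
      rwa [volume_restrict_prod, Measure.restrict_univ] at this
    exact (h1.prod_swap.integral_prod_right').const_smul (volume.real (s n))⁻¹
  · have hm : ∀ᵐ y : ℝ, AEStronglyMeasurable (fun x => f (x, y)) (volume.restrict I) :=
      hf.1.prodMk_right
    filter_upwards [hr, hm] with y hy hmy
    -- A limit outside null sets is enough for the averages to converge to it.
    have ho := hy.integral_sub_linear_isLittleO_ae
      ⟨I, self_mem_nhdsWithin, hmy⟩
      ((volume.finiteAt_nhds 0).inf_of_left) hst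
    have ho2 := ho.tendsto_inv_smul_nhds_zero
    have ho3 := ho2.add_const (r y)
    rw [zero_add] at ho3
    refine ho3.congr fun n => ?_
    rw [smul_sub, smul_smul, inv_mul_cancel₀ (hsp n).ne', one_smul, sub_add_cancel]

end Plane

/-! ### Energy density, trace estimate and `L²` bound on a half-plane -/

section Energy

/-- The energy density of `Ψ` on `Ω`. -/
noncomputable def energyDensity (Ω : Set (ℝ × ℝ)) (Ψ : ℝ × ℝ → ℂ) (p : ℝ × ℝ) : ℝ :=
  ‖weakDeriv Ω ex Ψ p‖ ^ 2 + (1 / 2) * ‖weakDeriv Ω ey Ψ p‖ ^ 2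
    + (1 / 2) * p.2 ^ 2 * ‖Ψ p‖ ^ 2

theorem energyDensity_nonneg (Ω : Set (ℝ × ℝ)) (Ψ : ℝ × ℝ → ℂ) (p : ℝ × ℝ) :
    0 ≤ energyDensity Ω Ψ p := by
  unfold energyDensity; positivity

theorem hasWeakDeriv_weakDeriv {Ω : Set (ℝ × ℝ)} {v : ℝ × ℝ} {f : ℝ × ℝ → ℂ}
    (h : ∃ g, HasWeakDeriv Ω v f g) : HasWeakDeriv Ω v f (weakDeriv Ω v f) := by
  rw [weakDeriv, dif_pos h]
  exact h.choose_spec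

variable {Ω : Set (ℝ × ℝ)} {Ψ : ℝ × ℝ → ℂ}

theorem MemH1.hasWeakDeriv_ex (h : MemH1 Ω Ψ) : HasWeakDeriv Ω ex Ψ (weakDeriv Ω ex Ψ) :=
  hasWeakDeriv_weakDeriv (h.2.1.imp fun _ hg => hg.1)

theorem MemH1.hasWeakDeriv_ey (h : MemH1 Ω Ψ) : HasWeakDeriv Ω ey Ψ (weakDeriv Ω ey Ψ) :=
  hasWeakDeriv_weakDeriv (h.2.2.imp fun _ hg => hg.1)

theorem MemH1.integrable_energyDensity (h : MemH1 Ω Ψ) (hE : energyOn Ω Ψ < ⊤) :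
    Integrable (energyDensity Ω Ψ) (volume.restrict Ω) := by
  have m1 := h.hasWeakDeriv_ex.2.1.aestronglyMeasurable
  have m2 := h.hasWeakDeriv_ey.2.1.aestronglyMeasurable
  have m3 := h.1.1
  have hm : AEStronglyMeasurable (energyDensity Ω Ψ) (volume.restrict Ω) := by
    refine ((m1.norm.pow 2).add ((m2.norm.pow 2).const_mul (1 / 2))).add ?_
    refine AEStronglyMeasurable.mul ?_ (m3.norm.pow 2)
    exact (by fun_prop : Continuous fun p : ℝ × ℝ => 1 / 2 * p.2 ^ 2).aestronglyMeasurable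
  refine ⟨hm, ?_⟩
  rw [hasFiniteIntegral_iff_ofReal (Eventually.of_forall (energyDensity_nonneg Ω Ψ))]
  exact hE

theorem MemH1.energyOn_toReal (h : MemH1 Ω Ψ) (hE : energyOn Ω Ψ < ⊤) :
    (energyOn Ω Ψ).toReal = ∫ p in Ω, energyDensity Ω Ψ p :=
  (integral_eq_lintegral_of_nonneg_ae (Eventually.of_forall (energyDensity_nonneg Ω Ψ))
    (h.integrable_energyDensity hE).1).symm

/-- `MemH1` provides some square-integrable weak derivative; for the chosen one, square
integrability is read off from the finite energy, which avoids the uniqueness of weak derivatives.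
-/
theorem MemH1.memLp_weakDeriv_ex (h : MemH1 Ω Ψ) (hE : energyOn Ω Ψ < ⊤) :
    MemLp (weakDeriv Ω ex Ψ) 2 (volume.restrict Ω) := by
  have m := h.hasWeakDeriv_ex.2.1.aestronglyMeasurable
  rw [memLp_two_iff_integrable_sq_norm m]
  refine (h.integrable_energyDensity hE).mono' (m.norm.pow 2) (Eventually.of_forall fun p => ?_)
  rw [Real.norm_of_nonneg (by positivity), energyDensity, add_assoc]
  exact le_add_of_nonneg_right (by positivity)

theorem MemH1.memLp_weakDeriv_ey (h : MemH1 Ω Ψ) (hE : energyOn Ω Ψ < ⊤) :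
    MemLp (weakDeriv Ω ey Ψ) 2 (volume.restrict Ω) := by
  have m := h.hasWeakDeriv_ey.2.1.aestronglyMeasurable
  rw [memLp_two_iff_integrable_sq_norm m]
  refine ((h.integrable_energyDensity hE).const_mul 2).mono' (m.norm.pow 2)
    (Eventually.of_forall fun p => ?_)
  rw [Real.norm_of_nonneg (by positivity), energyDensity]
  have h1 : 0 ≤ ‖weakDeriv Ω ex Ψ p‖ ^ 2 := by positivity
  have h2 : 0 ≤ 1 / 2 * p.2 ^ 2 * ‖Ψ p‖ ^ 2 := by positivity
  linarith

theorem norm_sq_eq_re_im (z : ℂ) :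
    ‖z‖ ^ 2 = (Complex.reCLM z) ^ 2 + (Complex.imCLM z) ^ 2 := by
  rw [Complex.sq_norm, Complex.normSq_apply, Complex.reCLM_apply, Complex.imCLM_apply]
  ring

theorem ae_memLp_slice_fst {μ ν : Measure ℝ} [SFinite μ] [SFinite ν] {f : ℝ × ℝ → ℂ}
    (hf : MemLp f 2 (μ.prod ν)) : ∀ᵐ y ∂ν, MemLp (fun x => f (x, y)) 2 μ := by
  have h1 : ∀ᵐ y ∂ν, AEStronglyMeasurable (fun x => f (x, y)) μ := hf.1.prodMk_right
  have h2 := ((memLp_two_iff_integrable_sq_norm hf.1).1 hf).prod_left_ae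
  filter_upwards [h1, h2] with y h1 h2
  rw [memLp_two_iff_integrable_sq_norm h1]
  exact h2

theorem ae_memLp_slice_snd {μ ν : Measure ℝ} [SFinite μ] [SFinite ν] {f : ℝ × ℝ → ℂ}
    (hf : MemLp f 2 (μ.prod ν)) : ∀ᵐ x ∂μ, MemLp (fun y => f (x, y)) 2 ν :=
  ae_memLp_slice_fst (hf.comp_measurePreserving Measure.measurePreserving_swap)

/-- The boundary values of `Ψ` at the edge of the half-plane `I × ℝ`, and the trace estimate. -/
theorem MemH1.ae_exists_trace {I : Set ℝ} (hI : IsOpen I) (hIc : I.OrdConnected)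
    (hIv : volume I = ⊤) (hI0 : ∀ x ∈ I, ∀ t ∈ uIcc 0 x, t ≠ 0 → t ∈ I)
    (h : MemH1 (I ×ˢ univ) Ψ) (hE : energyOn (I ×ˢ univ) Ψ < ⊤) :
    ∀ᵐ y : ℝ, ∃ c, Tendsto (fun x => Ψ (x, y)) (𝓝[I] 0 ⊓ ae volume) (𝓝 c) ∧
      |y| * ‖c‖ ^ 2 ≤ √2 * ∫ x in I, energyDensity (I ×ˢ univ) Ψ (x, y) := by
  have hw := h.memLp_weakDeriv_ex hE
  have hs := fun T => h.hasWeakDeriv_ex.ae_slice_fst isOpen_univ h.1 hw T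
  have hi := h.integrable_energyDensity hE
  have hΨ := h.1
  rw [volume_restrict_prod] at hi hw hΨ
  simp only [Measure.restrict_univ] at hs hi hw hΨ
  filter_upwards [hs Complex.reCLM, hs Complex.imCLM, hi.prod_left_ae, ae_memLp_slice_fst hw,
    ae_memLp_slice_fst hΨ] with y hre him hiy hwy hΨy
  obtain ⟨a, ha, ha'⟩ := hre.exists_trace hI hIc hIv hI0
    (MemLp.clm_comp_real hΨy _) (MemLp.clm_comp_real hwy _)
  obtain ⟨b, hb, hb'⟩ := him.exists_trace hI hIc hIv hI0
    (MemLp.clm_comp_real hΨy _) (MemLp.clm_comp_real hwy _)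
  refine ⟨⟨a, b⟩, ?_, ?_⟩
  · have : Tendsto (fun x => Complex.equivRealProdCLM.symm
        (Complex.reCLM (Ψ (x, y)), Complex.imCLM (Ψ (x, y)))) (𝓝[I] 0 ⊓ ae volume)
        (𝓝 (Complex.equivRealProdCLM.symm (a, b))) :=
      (Complex.equivRealProdCLM.symm.continuous.tendsto _).comp (ha.prodMk_nhds hb)
    exact this
  have hΨr := (MemLp.clm_comp_real hΨy Complex.reCLM).integrable_sq
  have hΨi := (MemLp.clm_comp_real hΨy Complex.imCLM).integrable_sq
  have hwr := (MemLp.clm_comp_real hwy Complex.reCLM).integrable_sq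
  have hwi := (MemLp.clm_comp_real hwy Complex.imCLM).integrable_sq
  -- Real and imaginary parts are added with `s = |y|`, which turns `½s²|Ψ|²` into the potential
  -- term of the energy; the `∂_y` term is dropped.
  have e := add_le_add (ha' |y| (abs_nonneg y)) (hb' |y| (abs_nonneg y))
  have i1 := hwr.fun_add (hΨr.const_mul (1 / 2 * |y| ^ 2))
  have i2 := hwi.fun_add (hΨi.const_mul (1 / 2 * |y| ^ 2))
  rw [← mul_add, ← mul_add, ← integral_add i1 i2] at e
  rw [norm_sq_eq_re_im]
  refine e.trans (mul_le_mul_of_nonneg_left ?_ (Real.sqrt_nonneg 2))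
  refine integral_mono (i1.add i2) hiy fun x => ?_
  simp only [energyDensity, sq_abs]
  rw [norm_sq_eq_re_im (Ψ (x, y)), norm_sq_eq_re_im (weakDeriv _ ex _ _)]
  have := sq_nonneg ‖weakDeriv (I ×ˢ univ) ey Ψ (x, y)‖
  linarith

/-- The energy controls the `L²` norm. -/
theorem MemH1.integral_norm_sq_le {I : Set ℝ} (hI : IsOpen I) (h : MemH1 (I ×ˢ univ) Ψ)
    (hE : energyOn (I ×ˢ univ) Ψ < ⊤) :
    ∫ p in I ×ˢ univ, ‖Ψ p‖ ^ 2 ≤ 2 * (energyOn (I ×ˢ univ) Ψ).toReal := by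
  rw [h.energyOn_toReal hE, ← integral_const_mul]
  have hw := h.memLp_weakDeriv_ey hE
  have hs := fun T => h.hasWeakDeriv_ey.ae_slice_snd hI h.1 hw T
  have hi := (h.integrable_energyDensity hE).const_mul 2
  have hΨ := h.1
  have hΨ2 := (memLp_two_iff_integrable_sq_norm hΨ.1).1 hΨ
  rw [volume_restrict_prod] at hi hw hΨ hΨ2 ⊢
  simp only [Measure.restrict_univ] at hs hi hw hΨ hΨ2 ⊢
  rw [integral_prod _ hΨ2, integral_prod _ hi]
  refine integral_mono_ae hΨ2.integral_prod_left hi.integral_prod_left ?_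
  filter_upwards [hs Complex.reCLM, hs Complex.imCLM, hi.prod_right_ae, ae_memLp_slice_snd hw,
    ae_memLp_slice_snd hΨ] with x hre him hix hwx hΨx
  have hΨm := fun T => MemLp.clm_comp_real hΨx T
  have hwm := fun T => MemLp.clm_comp_real hwx T
  -- The finite energy on almost every vertical line supplies the second moment that the oscillator
  -- bound needs.
  have hy : ∀ T : ℂ →L[ℝ] ℝ, (∀ z, (T z) ^ 2 ≤ ‖z‖ ^ 2) →
      Integrable fun y => y ^ 2 * (T (Ψ (x, y))) ^ 2 := by
    intro T hT
    refine hix.mono' ((by fun_prop : Continuous fun y : ℝ => y ^ 2).aestronglyMeasurable.mul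
      ((hΨm T).1.pow 2)) (Eventually.of_forall fun y => ?_)
    rw [Real.norm_of_nonneg (by positivity), energyDensity]
    have h1 := mul_le_mul_of_nonneg_left (hT (Ψ (x, y))) (sq_nonneg y)
    have h2 := sq_nonneg ‖weakDeriv (I ×ˢ univ) ex Ψ (x, y)‖
    have h3 := sq_nonneg ‖weakDeriv (I ×ˢ univ) ey Ψ (x, y)‖
    dsimp only
    linarith
  have hyr := hy Complex.reCLM fun z => by
    rw [norm_sq_eq_re_im]; exact le_add_of_nonneg_right (sq_nonneg _)
  have hyi := hy Complex.imCLM fun z => by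
    rw [norm_sq_eq_re_im]; exact le_add_of_nonneg_left (sq_nonneg _)
  have e := add_le_add (hre.integral_sq_le (hΨm _) (hwm _) hyr)
    (him.integral_sq_le (hΨm _) (hwm _) hyi)
  have i1 := (hwm Complex.reCLM).integrable_sq.fun_add hyr
  have i2 := (hwm Complex.imCLM).integrable_sq.fun_add hyi
  rw [← integral_add (hΨm Complex.reCLM).integrable_sq (hΨm Complex.imCLM).integrable_sq,
    ← integral_add i1 i2] at e
  simp_rw [← norm_sq_eq_re_im] at e
  refine e.trans (integral_mono (i1.add i2) hix fun y => ?_)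
  simp only [energyDensity]
  rw [norm_sq_eq_re_im (Ψ (x, y)), norm_sq_eq_re_im (weakDeriv _ ey _ _)]
  have := sq_nonneg ‖weakDeriv (I ×ˢ univ) ex Ψ (x, y)‖
  linarith

end Energy

/-! ### The two half-planes and the traces on the axis -/

section HalfPlanes

theorem rightHalf_eq : rightHalf = Ioi 0 ×ˢ univ := by
  ext p; simp [rightHalf]

theorem leftHalf_eq : leftHalf = Iio 0 ×ˢ univ := by
  ext p; simp [leftHalf]

/-- Neighbourhoods of `x` meet `I` in positive measure. Nontriviality makes limits unique, so
`limUnder` returns the trace that was constructed. -/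
theorem nhdsWithin_inf_ae_neBot {I : Set ℝ} (hI : IsOpen I) {x : ℝ} (hx : x ∈ closure I) :
    (𝓝[I] x ⊓ ae volume).NeBot := by
  rw [inf_neBot_iff]
  intro s hs t ht
  obtain ⟨u, huo, hxu, hus⟩ := mem_nhdsWithin.1 hs
  have hpos : 0 < volume (u ∩ I) :=
    (huo.inter hI).measure_pos volume (mem_closure_iff.1 hx u huo hxu)
  by_contra hne
  rw [not_nonempty_iff_eq_empty] at hne
  have hsub : u ∩ I ⊆ tᶜ := fun z hz hzt => by
    have : z ∈ s ∩ t := ⟨hus hz, hzt⟩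
    rw [hne] at this
    exact this
  exact hpos.ne' (measure_mono_null hsub (mem_ae_iff.1 ht))

instance zeroPlus_neBot : zeroPlus.NeBot := nhdsWithin_inf_ae_neBot isOpen_Ioi (by simp)

instance zeroMinus_neBot : zeroMinus.NeBot := nhdsWithin_inf_ae_neBot isOpen_Iio (by simp)

variable {Ψ : ℝ × ℝ → ℂ}

theorem MemH1.ae_rightTrace (h : MemH1 rightHalf Ψ) (hE : energyOn rightHalf Ψ < ⊤) :
    ∀ᵐ y : ℝ, Tendsto (fun x => Ψ (x, y)) zeroPlus (𝓝 (rightTrace Ψ y)) ∧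
      |y| * ‖rightTrace Ψ y‖ ^ 2 ≤ √2 * ∫ x in Ioi 0, energyDensity rightHalf Ψ (x, y) := by
  rw [rightHalf_eq] at h hE ⊢
  have hI0 : ∀ x ∈ Ioi (0 : ℝ), ∀ t ∈ uIcc 0 x, t ≠ 0 → t ∈ Ioi (0 : ℝ) := by
    intro x hx t ht ht0
    rw [uIcc_of_le (le_of_lt hx)] at ht
    exact lt_of_le_of_ne ht.1 ht0.symm
  filter_upwards [h.ae_exists_trace isOpen_Ioi ordConnected_Ioi (by simp) hI0 hE] with y hy
  obtain ⟨c, hc, hc'⟩ := hy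
  have hc : Tendsto (fun x => Ψ (x, y)) zeroPlus (𝓝 c) := hc
  have : rightTrace Ψ y = c := hc.limUnder_eq
  rw [this]
  exact ⟨hc, hc'⟩

theorem MemH1.ae_leftTrace (h : MemH1 leftHalf Ψ) (hE : energyOn leftHalf Ψ < ⊤) :
    ∀ᵐ y : ℝ, Tendsto (fun x => Ψ (x, y)) zeroMinus (𝓝 (leftTrace Ψ y)) ∧
      |y| * ‖leftTrace Ψ y‖ ^ 2 ≤ √2 * ∫ x in Iio 0, energyDensity leftHalf Ψ (x, y) := by
  rw [leftHalf_eq] at h hE ⊢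
  have hI0 : ∀ x ∈ Iio (0 : ℝ), ∀ t ∈ uIcc 0 x, t ≠ 0 → t ∈ Iio (0 : ℝ) := by
    intro x hx t ht ht0
    rw [uIcc_of_ge (le_of_lt hx)] at ht
    exact lt_of_le_of_ne ht.2 ht0
  filter_upwards [h.ae_exists_trace isOpen_Iio ordConnected_Iio (by simp) hI0 hE] with y hy
  obtain ⟨c, hc, hc'⟩ := hy
  have hc : Tendsto (fun x => Ψ (x, y)) zeroMinus (𝓝 c) := hc
  have : leftTrace Ψ y = c := hc.limUnder_eq
  rw [this]
  exact ⟨hc, hc'⟩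

theorem MemH1.aestronglyMeasurable_rightTrace (h : MemH1 rightHalf Ψ)
    (hE : energyOn rightHalf Ψ < ⊤) : AEStronglyMeasurable (rightTrace Ψ) := by
  refine aestronglyMeasurable_of_tendsto_slice isOpen_Ioi (by simp) (f := Ψ) ?_
    ((h.ae_rightTrace hE).mono fun y hy => hy.1)
  rw [← rightHalf_eq]; exact h.1

theorem MemH1.aestronglyMeasurable_leftTrace (h : MemH1 leftHalf Ψ)
    (hE : energyOn leftHalf Ψ < ⊤) : AEStronglyMeasurable (leftTrace Ψ) := by
  refine aestronglyMeasurable_of_tendsto_slice isOpen_Iio (by simp) (f := Ψ) ?_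
    ((h.ae_leftTrace hE).mono fun y hy => hy.1)
  rw [← leftHalf_eq]; exact h.1

/-- The energy of the horizontal lines is integrable, with integral the total energy. -/
theorem MemH1.integral_energyDensity_slice {I : Set ℝ} (h : MemH1 (I ×ˢ univ) Ψ)
    (hE : energyOn (I ×ˢ univ) Ψ < ⊤) :
    Integrable (fun y => ∫ x in I, energyDensity (I ×ˢ univ) Ψ (x, y)) ∧
      ∫ y, ∫ x in I, energyDensity (I ×ˢ univ) Ψ (x, y) = (energyOn (I ×ˢ univ) Ψ).toReal := by
  rw [h.energyOn_toReal hE]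
  have hi := h.integrable_energyDensity hE
  rw [volume_restrict_prod, Measure.restrict_univ] at hi ⊢
  exact ⟨hi.integral_prod_right, (integral_prod_symm _ hi).symm⟩

theorem energyOn_rightHalf_lt_top (h : Ψ ∈ formDomain) : energyOn rightHalf Ψ < ⊤ :=
  (ENNReal.add_lt_top.1 h.2.2).1

theorem energyOn_leftHalf_lt_top (h : Ψ ∈ formDomain) : energyOn leftHalf Ψ < ⊤ :=
  (ENNReal.add_lt_top.1 h.2.2).2

theorem a0_eq_add (h : Ψ ∈ formDomain) :
    a0 Ψ = (energyOn rightHalf Ψ).toReal + (energyOn leftHalf Ψ).toReal :=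
  ENNReal.toReal_add (energyOn_rightHalf_lt_top h).ne (energyOn_leftHalf_lt_top h).ne

/-- A boundary density dominated by `|y| (|Ψ(0+, y)|² + |Ψ(0-, y)|²)` is integrable, and its
integral is controlled by the energy. -/
theorem integrable_and_abs_integral_le_of_trace_bound (h : Ψ ∈ formDomain) {F : ℝ → ℝ}
    (hF : AEStronglyMeasurable F) {K : ℝ} (hK : 0 ≤ K)
    (hb : ∀ y, |F y| ≤ K * (|y| * (‖rightTrace Ψ y‖ ^ 2 + ‖leftTrace Ψ y‖ ^ 2))) :
    Integrable F ∧ |∫ y, F y| ≤ K * √2 * a0 Ψ := by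
  have hR := h.1.ae_rightTrace (energyOn_rightHalf_lt_top h)
  have hL := h.2.1.ae_leftTrace (energyOn_leftHalf_lt_top h)
  obtain ⟨iR, eR⟩ := MemH1.integral_energyDensity_slice (I := Ioi 0) (Ψ := Ψ)
    (by rw [← rightHalf_eq]; exact h.1)
    (by rw [← rightHalf_eq]; exact energyOn_rightHalf_lt_top h)
  obtain ⟨iL, eL⟩ := MemH1.integral_energyDensity_slice (I := Iio 0) (Ψ := Ψ)
    (by rw [← leftHalf_eq]; exact h.2.1)
    (by rw [← leftHalf_eq]; exact energyOn_leftHalf_lt_top h)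
  rw [← rightHalf_eq] at iR eR
  rw [← leftHalf_eq] at iL eL
  have hi := (iR.fun_add iL).const_mul (K * √2)
  have hle : ∀ᵐ y, ‖F y‖ ≤ K * √2 * ((∫ x in Ioi 0, energyDensity rightHalf Ψ (x, y)) +
      ∫ x in Iio 0, energyDensity leftHalf Ψ (x, y)) := by
    filter_upwards [hR, hL] with y hRy hLy
    refine (hb y).trans ?_
    rw [mul_assoc K]
    refine mul_le_mul_of_nonneg_left ?_ hK
    rw [mul_add, mul_add]
    exact add_le_add hRy.2 hLy.2
  refine ⟨hi.mono' hF hle, ?_⟩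
  refine (norm_integral_le_of_norm_le hi hle).trans_eq ?_
  rw [integral_const_mul, integral_add iR iL, eR, eL, a0_eq_add h]

theorem normSq_le (h : Ψ ∈ formDomain) : normSq Ψ ≤ 2 * a0 Ψ := by
  have hm : MeasurableSet rightHalf := by
    rw [rightHalf_eq]; exact measurableSet_Ioi.prod MeasurableSet.univ
  -- The axis `x = 0` is a null set.
  have hc : (volume : Measure (ℝ × ℝ)).restrict rightHalfᶜ = volume.restrict leftHalf := by
    have : rightHalfᶜ = Iic (0 : ℝ) ×ˢ univ := by ext p; simp [rightHalf]
    rw [this, leftHalf_eq, volume_restrict_prod, volume_restrict_prod,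
      Measure.restrict_congr_set Iio_ae_eq_Iic]
  have iR : IntegrableOn (fun p => ‖Ψ p‖ ^ 2) rightHalf :=
    (memLp_two_iff_integrable_sq_norm h.1.1.1).1 h.1.1
  have iL : IntegrableOn (fun p => ‖Ψ p‖ ^ 2) rightHalfᶜ := by
    rw [IntegrableOn, hc]
    exact (memLp_two_iff_integrable_sq_norm h.2.1.1.1).1 h.2.1.1
  have i : Integrable fun p => ‖Ψ p‖ ^ 2 := by
    rw [← integrableOn_univ, ← union_compl_self rightHalf]
    exact iR.union iL
  rw [normSq, ← integral_add_compl hm i, hc, a0_eq_add h, mul_add]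
  have hER := energyOn_rightHalf_lt_top h
  have hEL := energyOn_leftHalf_lt_top h
  obtain ⟨h1, h2, -⟩ := h
  rw [rightHalf_eq] at h1 hER ⊢
  rw [leftHalf_eq] at h2 hEL ⊢
  exact add_le_add (h1.integral_norm_sq_le isOpen_Ioi hER)
    (h2.integral_norm_sq_le isOpen_Iio hEL)

end HalfPlanes

/-! ### Bounds for the boundary forms -/

section BoundaryForms

theorem kappa_nonneg (α β : ℝ) (γ : ℂ) : 0 ≤ kappa α β γ := by
  unfold kappa; positivity

/-- The spectral bound of the quadratic form `X² + c/4 Y² + t` with `|t| ≤ g X Y`. -/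
theorem abs_quadratic_le {c g X Y t : ℝ} (ht : |t| ≤ g * (X * Y)) :
    |X ^ 2 + c / 4 * Y ^ 2 + t|
      ≤ (|4 + c| + √((c - 4) ^ 2 + 16 * g ^ 2)) / 8 * (X ^ 2 + Y ^ 2) := by
  -- Cauchy–Schwarz for the vectors `(|c - 4|, 4g)` and `(|X² - Y²|, 2XY)`, the second of which has
  -- length `X² + Y²`.
  have hD : |c - 4| * |X ^ 2 - Y ^ 2| + 8 * (g * (X * Y))
      ≤ √((c - 4) ^ 2 + 16 * g ^ 2) * (X ^ 2 + Y ^ 2) := by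
    have hs : 0 ≤ X ^ 2 + Y ^ 2 := by positivity
    rw [← Real.sqrt_sq hs, ← Real.sqrt_mul (by positivity)]
    refine Real.le_sqrt_of_sq_le ?_
    have h1 := sq_abs (c - 4)
    have h2 := sq_abs (X ^ 2 - Y ^ 2)
    have h3 := sq_nonneg (|c - 4| * (2 * (X * Y)) - 4 * g * |X ^ 2 - Y ^ 2|)
    have h4 : (X ^ 2 + Y ^ 2) ^ 2 = |X ^ 2 - Y ^ 2| ^ 2 + (2 * (X * Y)) ^ 2 := by rw [h2]; ring
    rw [h4, ← h1]
    linarith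
  have e : X ^ 2 + c / 4 * Y ^ 2 + t
      = (4 + c) / 8 * (X ^ 2 + Y ^ 2) + (-((c - 4) * (X ^ 2 - Y ^ 2)) / 8 + t) := by ring
  have e1 : |(4 + c) / 8 * (X ^ 2 + Y ^ 2)| = |4 + c| / 8 * (X ^ 2 + Y ^ 2) := by
    rw [abs_mul, abs_div, abs_of_nonneg (by positivity : 0 ≤ X ^ 2 + Y ^ 2)]
    norm_num
  have e2 : |-((c - 4) * (X ^ 2 - Y ^ 2)) / 8| = |c - 4| * |X ^ 2 - Y ^ 2| / 8 := by
    rw [abs_div, abs_neg, abs_mul]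
    norm_num
  have a1 := abs_add_le ((4 + c) / 8 * (X ^ 2 + Y ^ 2)) (-((c - 4) * (X ^ 2 - Y ^ 2)) / 8 + t)
  have a2 := abs_add_le (-((c - 4) * (X ^ 2 - Y ^ 2)) / 8) t
  rw [e]
  linarith

theorem norm_sub_sq_add_norm_add_sq (r l : ℂ) :
    ‖r - l‖ ^ 2 + ‖r + l‖ ^ 2 = 2 * (‖r‖ ^ 2 + ‖l‖ ^ 2) := by
  have := parallelogram_law_with_norm ℝ r l
  linarith

theorem abs_mixed_le (γ r l : ℂ) :
    |(γ * (conj r + conj l) * (r - l)).re| ≤ ‖γ‖ * (‖r - l‖ * ‖r + l‖) := by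
  refine (Complex.abs_re_le_norm _).trans_eq ?_
  rw [← map_add, norm_mul, norm_mul, RCLike.norm_conj]
  ring

variable {Ψ : ℝ × ℝ → ℂ} {α β : ℝ} {γ : ℂ}

theorem integrable_b1Integrand (h : Ψ ∈ formDomain) : Integrable (b1Integrand Ψ) := by
  have mR := h.1.aestronglyMeasurable_rightTrace (energyOn_rightHalf_lt_top h)
  have mL := h.2.1.aestronglyMeasurable_leftTrace (energyOn_leftHalf_lt_top h)
  refine (integrable_and_abs_integral_le_of_trace_bound h
    (aestronglyMeasurable_id.mul ((mR.sub mL).norm.pow 2)) zero_le_two fun y => ?_).1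
  change |y * ‖rightTrace Ψ y - leftTrace Ψ y‖ ^ 2| ≤ _
  rw [abs_mul, abs_of_nonneg (sq_nonneg ‖_‖), mul_left_comm]
  refine mul_le_mul_of_nonneg_left ?_ (abs_nonneg y)
  have := norm_sub_sq_add_norm_add_sq (rightTrace Ψ y) (leftTrace Ψ y)
  have := sq_nonneg ‖rightTrace Ψ y + leftTrace Ψ y‖
  linarith

/-- Serves `b₂` with `k = αβ + |γ|²` and `b₄` with `k = α`. -/
theorem weighted_sum_bound (h : Ψ ∈ formDomain) (k : ℝ) :
    Integrable (fun y => k / 4 * y * ‖rightTrace Ψ y + leftTrace Ψ y‖ ^ 2) ∧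
      |∫ y, k / 4 * y * ‖rightTrace Ψ y + leftTrace Ψ y‖ ^ 2| ≤ |k| / 2 * √2 * a0 Ψ := by
  have mR := h.1.aestronglyMeasurable_rightTrace (energyOn_rightHalf_lt_top h)
  have mL := h.2.1.aestronglyMeasurable_leftTrace (energyOn_leftHalf_lt_top h)
  refine integrable_and_abs_integral_le_of_trace_bound h
    ((aestronglyMeasurable_id.const_mul (k / 4)).mul ((mR.add mL).norm.pow 2))
    (by positivity) fun y => ?_
  change |k / 4 * y * ‖rightTrace Ψ y + leftTrace Ψ y‖ ^ 2| ≤ _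
  rw [abs_mul, abs_mul, abs_of_nonneg (sq_nonneg ‖_‖), abs_div, abs_of_pos (zero_lt_four' ℝ)]
  have h1 := norm_sub_sq_add_norm_add_sq (rightTrace Ψ y) (leftTrace Ψ y)
  have h2 := sq_nonneg ‖rightTrace Ψ y - leftTrace Ψ y‖
  have h3 : ‖rightTrace Ψ y + leftTrace Ψ y‖ ^ 2
      ≤ 2 * (‖rightTrace Ψ y‖ ^ 2 + ‖leftTrace Ψ y‖ ^ 2) := by linarith
  calc _ ≤ |k| / 4 * |y| * (2 * (‖rightTrace Ψ y‖ ^ 2 + ‖leftTrace Ψ y‖ ^ 2)) := by gcongr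
    _ = _ := by ring

theorem integrable_b3Integrand (h : Ψ ∈ formDomain) : Integrable (b3Integrand γ Ψ) := by
  have mR := h.1.aestronglyMeasurable_rightTrace (energyOn_rightHalf_lt_top h)
  have mL := h.2.1.aestronglyMeasurable_leftTrace (energyOn_leftHalf_lt_top h)
  have mc : ∀ {f : ℝ → ℂ}, AEStronglyMeasurable f →
      AEStronglyMeasurable fun y => conj (f y) := fun hf =>
    Complex.continuous_conj.comp_aestronglyMeasurable hf
  refine (integrable_and_abs_integral_le_of_trace_bound h
    (aestronglyMeasurable_id.mul (Complex.continuous_re.comp_aestronglyMeasurable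
      ((((mc mR).add (mc mL)).const_mul γ).mul (mR.sub mL)))) (norm_nonneg γ) fun y => ?_).1
  change |y * (γ * (conj (rightTrace Ψ y) + conj (leftTrace Ψ y))
    * (rightTrace Ψ y - leftTrace Ψ y)).re| ≤ _
  rw [abs_mul, mul_left_comm]
  refine mul_le_mul_of_nonneg_left ((abs_mixed_le _ _ _).trans ?_) (abs_nonneg y)
  refine mul_le_mul_of_nonneg_left ?_ (norm_nonneg γ)
  have h1 := norm_sub_sq_add_norm_add_sq (rightTrace Ψ y) (leftTrace Ψ y)
  have h2 := two_mul_le_add_sq ‖rightTrace Ψ y - leftTrace Ψ y‖ ‖rightTrace Ψ y + leftTrace Ψ y‖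
  linarith

/-- The three densities are estimated jointly, as one quadratic expression; bounding them one by one
would lose the constant `κ`. -/
theorem abs_b123_le (h : Ψ ∈ formDomain) :
    |b1 Ψ + b2 α β γ Ψ + b3 γ Ψ| ≤ kappa α β γ / (2 * √2) * a0 Ψ := by
  have i1 := integrable_b1Integrand h
  have i2 : Integrable (b2Integrand α β γ Ψ) := (weighted_sum_bound h _).1
  have i3 : Integrable (b3Integrand γ Ψ) := integrable_b3Integrand h
  have e : b1 Ψ + b2 α β γ Ψ + b3 γ Ψ
      = ∫ y, (b1Integrand Ψ y + b2Integrand α β γ Ψ y + b3Integrand γ Ψ y) := by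
    rw [integral_add (i1.fun_add i2) i3, integral_add i1 i2, b1, b2, b3]
  have e2 : kappa α β γ / (2 * √2) = kappa α β γ / 4 * √2 := by
    field_simp
    rw [Real.sq_sqrt (by norm_num)]
    ring
  rw [e, e2]
  refine (integrable_and_abs_integral_le_of_trace_bound h ((i1.fun_add i2).fun_add i3).1
    (by have := kappa_nonneg α β γ; positivity) fun y => ?_).2
  have e3 : b1Integrand Ψ y + b2Integrand α β γ Ψ y + b3Integrand γ Ψ y
      = y * (‖rightTrace Ψ y - leftTrace Ψ y‖ ^ 2
        + (α * β + ‖γ‖ ^ 2) / 4 * ‖rightTrace Ψ y + leftTrace Ψ y‖ ^ 2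
        + (γ * (conj (rightTrace Ψ y) + conj (leftTrace Ψ y))
          * (rightTrace Ψ y - leftTrace Ψ y)).re) := by
    simp only [b1Integrand, b2Integrand, b3Integrand]; ring
  rw [e3, abs_mul, mul_left_comm]
  refine mul_le_mul_of_nonneg_left ?_ (abs_nonneg y)
  refine (abs_quadratic_le (abs_mixed_le γ (rightTrace Ψ y) (leftTrace Ψ y))).trans_eq ?_
  rw [norm_sub_sq_add_norm_add_sq, kappa, ← add_assoc 4]
  ring

theorem abs_b4_le (h : Ψ ∈ formDomain) : |b4 α Ψ| ≤ |α| / √2 * a0 Ψ := by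
  refine (weighted_sum_bound h α).2.trans_eq ?_
  congr 1
  field_simp
  rw [Real.sq_sqrt (by norm_num)]

theorem half_mul_normSq_le (h : Ψ ∈ formDomain) {s : ℝ} (hs : s ≤ 1) :
    1 / 2 * (1 - s) * normSq Ψ ≤ (1 - s) * a0 Ψ := by
  have := mul_le_mul_of_nonneg_left (normSq_le h) (sub_nonneg.2 hs)
  linarith

end BoundaryForms

end SpectralTransition

open SpectralTransition

theorem mainTheorem7 (α β : ℝ) (γ : ℂ) (Ψ : ℝ × ℝ → ℂ)
    (hΨ : Ψ ∈ SpectralTransition.formDomain) :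
    -- the boundary values exist, and the boundary forms are given by convergent integrals
    (∀ᵐ y : ℝ,
      Tendsto (fun x => Ψ (x, y)) SpectralTransition.zeroPlus
        (𝓝 (SpectralTransition.rightTrace Ψ y)) ∧
      Tendsto (fun x => Ψ (x, y)) SpectralTransition.zeroMinus
        (𝓝 (SpectralTransition.leftTrace Ψ y))) ∧
    Integrable (SpectralTransition.b1Integrand Ψ) ∧
    Integrable (SpectralTransition.b2Integrand α β γ Ψ) ∧
    Integrable (SpectralTransition.b3Integrand γ Ψ) ∧
    Integrable (SpectralTransition.b4Integrand α Ψ) ∧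
    -- the upper bounds for the boundary forms
    SpectralTransition.b1 Ψ + SpectralTransition.b2 α β γ Ψ + SpectralTransition.b3 γ Ψ
      ≤ SpectralTransition.kappa α β γ / (2 * √2) * SpectralTransition.a0 Ψ ∧
    SpectralTransition.b4 α Ψ ≤ |α| / √2 * SpectralTransition.a0 Ψ ∧
    -- the lower bounds for the full form
    (β ≠ 0 →
      (1 - SpectralTransition.kappa α β γ / (2 * √2 * |β|)) * SpectralTransition.a0 Ψ
          ≤ SpectralTransition.aForm α β γ Ψ ∧
      (SpectralTransition.kappa α β γ / (2 * √2 * |β|) ≤ 1 →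
        1 / 2 * (1 - SpectralTransition.kappa α β γ / (2 * √2 * |β|)) *
            SpectralTransition.normSq Ψ
          ≤ (1 - SpectralTransition.kappa α β γ / (2 * √2 * |β|)) *
            SpectralTransition.a0 Ψ)) ∧
    (β = 0 →
      (1 - |α| / √2) * SpectralTransition.a0 Ψ ≤ SpectralTransition.aForm α 0 γ Ψ ∧
      (|α| / √2 ≤ 1 →
        1 / 2 * (1 - |α| / √2) * SpectralTransition.normSq Ψ
          ≤ (1 - |α| / √2) * SpectralTransition.a0 Ψ)) := by
  have hB := abs_b123_le (α := α) (β := β) (γ := γ) hΨ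
  have hB4 := abs_b4_le (α := α) hΨ
  refine ⟨?_, integrable_b1Integrand hΨ, (weighted_sum_bound hΨ _).1, integrable_b3Integrand hΨ, (weighted_sum_bound hΨ _).1,
    (le_abs_self _).trans hB, (le_abs_self _).trans hB4, fun hβ => ⟨?_, half_mul_normSq_le hΨ⟩,
    fun _ => ⟨?_, half_mul_normSq_le hΨ⟩⟩
  · filter_upwards [hΨ.1.ae_rightTrace (energyOn_rightHalf_lt_top hΨ),
      hΨ.2.1.ae_leftTrace (energyOn_leftHalf_lt_top hΨ)] with y hR hL
    exact ⟨hR.1, hL.1⟩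
  · rw [aForm, if_neg hβ]
    -- The two-sided bound is needed here: for negative `β` it is the lower bound on the boundary
    -- forms that would fail to follow from the upper one.
    have h1 : |1 / β * (b1 Ψ + b2 α β γ Ψ + b3 γ Ψ)|
        ≤ kappa α β γ / (2 * √2 * |β|) * a0 Ψ := by
      rw [abs_mul, abs_div, abs_one]
      refine (mul_le_mul_of_nonneg_left hB (by positivity)).trans_eq ?_
      have := abs_pos.2 hβ
      field_simp
    have h2 := neg_le_of_abs_le h1
    linarith
  · rw [aForm, if_pos rfl]
    have h2 := neg_le_of_abs_le hB4
    linarith
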